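/- **Model.** Let $\mathbb X$ (states) and $\mathbb A$ (actions) be Borel subsets of Polish spaces. For each $x\in\mathbb X$ let $A(x)\subseteq\mathbb A$ be a nonempty set of available actions such that the graph $\mathrm{Gr}(A)=\{(x,a):x\in\mathbb X,\ a\in A(x)\}$ is Borel in $\mathbb X\times\mathbb A$ and there is a Borel map $\phi:\mathbb X\to\mathbb A$ with $\phi(x)\in A(x)$ for all $x$. Let the cost $c:\mathrm{Gr}(A)\to(-\infty,+\infty]$ be Borel and bounded below, and let $q(\cdot\mid x,a)$ be probability measures on $\mathbb X$ such that $q(B\mid\cdot,\cdot)$ is Borel on $\mathrm{Gr}(A)$ for every Borel $B\subseteq\mathbb X$. A policy $\pi=(\pi_n)_{n\ge0}$ is a sequence of transition probabilities $\pi_n$ from the histories $(\mathbb X\times\mathbb A)^n\times\mathbb X$ to $\mathbb A$ with $\pi_n(A(x_n)\mid x_0,a_0,\dots,a_{n-1},x_n)=1$. A stationary policy is a Borel map $\phi:\mathbb X\to\mathbb A$ with $\phi(x)\in A(x)$ for all $x$, identified with the policy that chooses $\phi(x_n)$ at each time $n$. Let $\mathbb E_x^\pi$ be the expectation for the law on trajectories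 $(x_0,a_0,x_1,a_1,\dots)$ determined by $x_0=x$, $\pi$ and $q$. Put $$v_N^\pi(x)=\mathbb E_x^\pi\sum_{n=0}^{N-1}c(x_n,a_n),\quad v_\alpha^\pi(x)=\mathbb E_x^\pi\sum_{n=0}^{\infty}\alpha^nc(x_n,a_n)\ (0\le\alpha<1),\quad w^\pi(x)=\limsup_{N\to\infty}\tfrac1N v_N^\pi(x),$$ $v_\alpha(x)=\inf_\pi v_\alpha^\pi(x)$, $w(x)=\inf_\pi w^\pi(x)$, $w^*=\inf_{x}w(x)$, $m_\alpha=\inf_xv_\alpha(x)$, $u_\alpha(x)=v_\alpha(x)-m_\alpha$, $\overline w=\limsup_{\alpha\uparrow1}(1-\alpha)m_\alpha$. A policy $\pi$ is average-cost optimal if $w^\pi(x)=w(x)$ for all $x$. A function is inf-compact if all its level sets $\{f\le\lambda\}$, $\lambda\in\mathbb R$, are compact. **Assumptions.** * $(\mathbf W^*)$: (i) $c$ is lower semicontinuous and bounded below on $\mathrm{Gr}(A)$; (ii) if $x_n\to x$ in $\mathbb X$, $a_n\in A(x_n)$ and the sequence $c(x_n,a_n)$ is bounded above, then $(a_n)$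 has a limit point in $A(x)$; (iii) $q(\cdot\mid x,a)$ is weakly continuous in $(x,a)\in\mathrm{Gr}(A)$. * $(\underline{\mathbf B})$: $w^*<\infty$, and $\liminf_{\alpha\uparrow1}u_\alpha(x)<\infty$ for all $x\in\mathbb X$. * $(\mathbf{Wu})$: $c$ is inf-compact on $\mathrm{Gr}(A)$, and $(\mathbf W^*)$(iii) holds. **Theorem.** Suppose $(\mathbf W^*)$ and $(\underline{\mathbf B})$ hold. Define, for $x\in\mathbb X$, $$u(x)=\liminf_{\alpha\uparrow1,\ y\to x}u_\alpha(y)=\sup_{\beta\in[0,1),\,R>0}\ \inf\{u_\alpha(y):\alpha\in[\beta,1),\ y\in B_R(x)\},$$ $$A^*(x)=\Big\{a\in A(x):\ \overline w+u(x)\ge c(x,a)+\int u(y)\,q(dy\mid x,a)\Big\},$$ $$A_*(x)=\Big\{a\in A(x):\ c(x,a)+\int u(y)\,q(dy\mid x,a)=\inf_{b\in A(x)}\Big[c(x,b)+\int u(y)\,q(dy\mid x,b)\Big]\Big\}.$$ Then there exists a stationary policy $\phi$ with $$\overline w+u(x)\ge c(x,\phi(x))+\int u(y)\,q(dy\mid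 x,\phi(x)),\qquad x\in\mathbb X,\tag{1}$$ which is average-cost optimal and satisfies $$w(x)=w^\phi(x)=\limsup_{\alpha\uparrow1}(1-\alpha)v_\alpha(x)=\overline w=w^*,\qquad x\in\mathbb X.\tag{2}$$ Furthermore: (a) $u$ takes values in $[0,\infty)$ and is lower semicontinuous; (b) the sets $A^*(x)$, $x\in\mathbb X$, are nonempty and compact, and the graph $\{(x,a):x\in\mathbb X,\ a\in A^*(x)\}$ is a Borel subset of $\mathbb X\times\mathbb A$; (c) every stationary policy $\phi$ with $\phi(x)\in A^*(x)$ for all $x\in\mathbb X$ is average-cost optimal and satisfies (1) and (2); (d) $A_*(x)\subseteq A^*(x)$ for all $x\in\mathbb X$, and there exists a stationary policy $\phi$ with $\phi(x)\in A_*(x)$ for all $x\in\mathbb X$; (e) if, in addition, $(\mathbf{Wu})$ holds, then $u$ is inf-compact. -/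

import Mathlib

open MeasureTheory ProbabilityTheory Filter Topology
open scoped ENNReal BoundedContinuousFunction

/-- Lebesgue integral of an extended-real function: the integral of the positive part minus the
integral of the negative part. It is used only where the integral of the negative part is
finite. -/
noncomputable def extIntegral {Ω : Type*} [MeasurableSpace Ω] (μ : Measure Ω) (f : Ω → EReal) :
    EReal :=
  ((∫⁻ ω, (f ω).toENNReal ∂μ : ℝ≥0∞) : EReal) - ((∫⁻ ω, (-f ω).toENNReal ∂μ : ℝ≥0∞) : EReal)

/-- Sum of a series of extended reals: the sum of the positive parts minus the sum of the negative
parts. It is used only where the sum of the negative parts is finite. -/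
noncomputable def extSum (f : ℕ → EReal) : EReal :=
  ((∑' n, (f n).toENNReal : ℝ≥0∞) : EReal) - ((∑' n, (-f n).toENNReal : ℝ≥0∞) : EReal)

/-- All level sets `{y ∈ s | f y ≤ r}`, `r` real, are compact. -/
def InfCompactOn {S : Type*} [TopologicalSpace S] (f : S → EReal) (s : Set S) : Prop :=
  ∀ r : ℝ, IsCompact {y | y ∈ s ∧ f y ≤ (r : EReal)}

/-- A discrete-time Markov decision process with states `X` and actions `A`. The values of `cost`
outside the graph of `actions` are irrelevant. -/
structure MDP (X A : Type*) [MeasurableSpace X] [MeasurableSpace A] where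
  /-- the set of actions available in a state -/
  actions : X → Set A
  measurableSet_graph : MeasurableSet {p : X × A | p.2 ∈ actions p.1}
  exists_selector : ∃ φ : X → A, Measurable φ ∧ ∀ x, φ x ∈ actions x
  /-- the one-step cost, with values in `(-∞, +∞]` on the graph -/
  cost : X × A → EReal
  measurable_cost : Measurable fun p : {p : X × A | p.2 ∈ actions p.1} => cost p
  cost_bddBelow : ∃ K : ℝ, ∀ p : X × A, p.2 ∈ actions p.1 → (K : EReal) ≤ cost p
  /-- the transition probabilities -/
  trans : X × A → Measure X
  isProbabilityMeasure_trans : ∀ p, IsProbabilityMeasure (trans p)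
  measurable_trans : ∀ B : Set X, MeasurableSet B →
    Measurable fun p : {p : X × A | p.2 ∈ actions p.1} => trans p B

namespace MDP

variable {X A : Type*} [MeasurableSpace X] [MeasurableSpace A]

/-- The graph `Gr(A)`. -/
def graph (M : MDP X A) : Set (X × A) := {p | p.2 ∈ M.actions p.1}

open Classical in
/-- The transition probabilities on the graph, as a kernel on `X × A`. Off the graph, where the
process never is, the state is kept. -/
noncomputable def transKernel (M : MDP X A) : Kernel (X × A) X where
  toFun p := if p ∈ M.graph then M.trans p else Measure.dirac p.1
  measurable' := by
    refine Measure.measurable_of_measurable_coe _ fun B hB => ?_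
    have hG : MeasurableSet M.graph := M.measurableSet_graph
    refine measurable_of_restrict_of_restrict_compl hG ?_ ?_
    · have h : Measurable fun p : M.graph => M.trans p B := M.measurable_trans B hB
      refine (congrArg Measurable (funext fun p => ?_)).mp h
      exact congrArg (fun μ : Measure X => μ B) (if_pos p.2).symm
    · have h : Measurable fun p : ↥(M.graph)ᶜ => Measure.dirac (p : X × A).1 B :=
        (Measure.measurable_coe hB).comp
          (Measure.measurable_dirac.comp (measurable_fst.comp measurable_subtype_coe))
      refine (congrArg Measurable (funext fun p => ?_)).mp h
      exact congrArg (fun μ : Measure X => μ B) (if_neg p.2).symm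

instance (M : MDP X A) : IsMarkovKernel M.transKernel where
  isProbabilityMeasure p := by
    classical
    change IsProbabilityMeasure (if p ∈ M.graph then M.trans p else Measure.dirac p.1)
    split_ifs
    · exact M.isProbabilityMeasure_trans p
    · infer_instance

/-- A (randomized, history-dependent) policy: at each epoch `n` a stochastic kernel from the
histories `(X × A)^n × X` to the actions, concentrated on the actions available in the current
state. -/
structure Policy (M : MDP X A) where
  rule : (n : ℕ) → Kernel ((Fin n → X × A) × X) A
  isMarkovKernel_rule : ∀ n, IsMarkovKernel (rule n)
  rule_actions : ∀ n h, rule n h (M.actions h.2) = 1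

/-- A stationary policy: a measurable selector of `actions`. -/
structure StationaryPolicy (M : MDP X A) where
  toFun : X → A
  measurable : Measurable toFun
  mem_actions : ∀ x, toFun x ∈ M.actions x

/-- The policy that always chooses the action `φ x` in the state `x`. -/
noncomputable def StationaryPolicy.toPolicy {M : MDP X A} (φ : M.StationaryPolicy) :
    M.Policy where
  rule n := Kernel.deterministic (fun h : (Fin n → X × A) × X => φ.toFun h.2)
    (φ.measurable.comp measurable_snd)
  isMarkovKernel_rule _ := inferInstance
  rule_actions n h := by
    have hm : MeasurableSet (M.actions h.2) :=
      M.measurableSet_graph.preimage measurable_prodMk_left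
    rw [Kernel.deterministic_apply' _ _ hm]
    simp [φ.mem_actions]

/-- Joint law of the next state and the next action, given the states and actions up to time
`n`. -/
noncomputable def stepKernel (M : MDP X A) (π : M.Policy) (n : ℕ) :
    Kernel ((i : Finset.Iic n) → X × A) (X × A) :=
  (M.transKernel.comap (fun h : (i : Finset.Iic n) → X × A => h ⟨n, Finset.mem_Iic.2 le_rfl⟩)
      (measurable_pi_apply _)) ⊗ₖ
    ((π.rule (n + 1)).comap
      (fun p : ((i : Finset.Iic n) → X × A) × X =>
        ((fun i : Fin (n + 1) => p.1 ⟨i, Finset.mem_Iic.2 (Nat.lt_succ_iff.1 i.2)⟩), p.2))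
      (by fun_prop))

instance (M : MDP X A) (π : M.Policy) (n : ℕ) : IsMarkovKernel (M.stepKernel π n) := by
  have := π.isMarkovKernel_rule (n + 1)
  unfold stepKernel
  infer_instance

/-- Law of the initial state-action pair when the initial state is `x`. -/
noncomputable def initialLaw (M : MDP X A) (π : M.Policy) (x : X) : Measure (X × A) :=
  (π.rule 0 (Fin.elim0, x)).map fun a => (x, a)

/-- The probability `P_x^π` on the trajectories `(x₀, a₀, x₁, a₁, …)`. -/
noncomputable def pathMeasure (M : MDP X A) (π : M.Policy) (x : X) : Measure (ℕ → X × A) :=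
  Kernel.trajMeasure (X := fun _ => X × A) (M.initialLaw π x) (M.stepKernel π)

/-- Expected total cost `v_N^π(x)` over the horizon `N`. -/
noncomputable def horizonCost (M : MDP X A) (π : M.Policy) (N : ℕ) (x : X) : EReal :=
  extIntegral (M.pathMeasure π x) fun ω => ∑ n ∈ Finset.range N, M.cost (ω n)

/-- Expected total discounted cost `v_α^π(x)` over the infinite horizon, for `α ∈ [0, 1)`. -/
noncomputable def discCost (M : MDP X A) (π : M.Policy) (α : ℝ) (x : X) : EReal :=
  extIntegral (M.pathMeasure π x) fun ω => extSum fun n => ((α ^ n : ℝ) : EReal) * M.cost (ω n)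

/-- Average cost per unit time `w^π(x)`. -/
noncomputable def avgCost (M : MDP X A) (π : M.Policy) (x : X) : EReal :=
  limsup (fun N : ℕ => (((N : ℝ)⁻¹ : ℝ) : EReal) * M.horizonCost π N x) atTop

/-- Optimal discounted cost `v_α(x)`. -/
noncomputable def discValue (M : MDP X A) (α : ℝ) (x : X) : EReal :=
  ⨅ π : M.Policy, M.discCost π α x

/-- Optimal average cost `w(x)`. -/
noncomputable def avgValue (M : MDP X A) (x : X) : EReal :=
  ⨅ π : M.Policy, M.avgCost π x

/-- The policy `π` is average-cost optimal. -/
def IsAvgOptimal (M : MDP X A) (π : M.Policy) : Prop :=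
  ∀ x, M.avgCost π x = M.avgValue x

/-- `w^* = inf_x w(x)`. -/
noncomputable def wStar (M : MDP X A) : EReal := ⨅ x, M.avgValue x

/-- `m_α = inf_x v_α(x)`. -/
noncomputable def minDisc (M : MDP X A) (α : ℝ) : EReal := ⨅ x, M.discValue α x

/-- `u_α(x) = v_α(x) - m_α`. -/
noncomputable def relDisc (M : MDP X A) (α : ℝ) (x : X) : EReal :=
  M.discValue α x - M.minDisc α

/-- The upper limit of `(1 - α) m_α` as `α ↑ 1`. -/
noncomputable def wBar (M : MDP X A) : EReal :=
  limsup (fun α : ℝ => ((1 - α : ℝ) : EReal) * M.minDisc α) (𝓝[<] 1)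

/-- `c(x, a) + ∫ f dq(· | x, a)`. -/
noncomputable def oneStep (M : MDP X A) (f : X → EReal) (x : X) (a : A) : EReal :=
  M.cost (x, a) + extIntegral (M.trans (x, a)) f

/-- The set of actions `a ∈ A(x)` with `w̄ + f(x) ≥ c(x, a) + ∫ f dq(· | x, a)`. -/
def acoiActions (M : MDP X A) (f : X → EReal) (x : X) : Set A :=
  {a | a ∈ M.actions x ∧ M.oneStep f x a ≤ M.wBar + f x}

/-- The set of actions that minimize `c(x, a) + ∫ f dq(· | x, a)` over `A(x)`. -/
def minActions (M : MDP X A) (f : X → EReal) (x : X) : Set A :=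
  {a | a ∈ M.actions x ∧ (⨅ b ∈ M.actions x, M.oneStep f x b) = M.oneStep f x a}

/-- The Assumption (`B` underlined): `w^* < ∞`, and the lower limit of `u_α(x)` as `α ↑ 1` is
finite for every `x`. -/
structure AssumptionB (M : MDP X A) : Prop where
  general : M.wStar < ⊤
  liminf_lt : ∀ x, liminf (fun α : ℝ => M.relDisc α x) (𝓝[<] 1) < ⊤

variable [TopologicalSpace X] [TopologicalSpace A]

/-- `u(x)`, the lower limit of `u_α(y)` as `α ↑ 1` and `y → x`. -/
noncomputable def relLimit (M : MDP X A) (x : X) : EReal :=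
  liminf (fun p : ℝ × X => M.relDisc p.1 p.2) (𝓝[<] (1 : ℝ) ×ˢ 𝓝 x)

/-- The transition probabilities are weakly continuous on the graph. -/
def WeaklyContinuous (M : MDP X A) : Prop :=
  ∀ f : X →ᵇ ℝ, ContinuousOn (fun p => ∫ z, f z ∂(M.trans p)) M.graph

/-- Assumption (W*). -/
structure AssumptionWStar (M : MDP X A) : Prop where
  lsc_cost : LowerSemicontinuousOn M.cost M.graph
  bddBelow : ∃ K : ℝ, ∀ p ∈ M.graph, (K : EReal) ≤ M.cost p
  limit_point : ∀ (x : ℕ → X) (x₀ : X), Tendsto x atTop (𝓝 x₀) →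
    ∀ a : ℕ → A, (∀ n, a n ∈ M.actions (x n)) →
      (∃ C : ℝ, ∀ n, M.cost (x n, a n) ≤ (C : EReal)) →
      ∃ a₀ ∈ M.actions x₀, MapClusterPt a₀ atTop a
  weak : M.WeaklyContinuous

/-- Assumption (Wu). -/
structure AssumptionWu (M : MDP X A) : Prop where
  infCompact_cost : InfCompactOn M.cost M.graph
  weak : M.WeaklyContinuous

end MDP

/-! Adding a constant to the cost shifts every value by an explicit amount, so the cost may be taken
with values in `[0, ∞]`, where integrals, sums and lower limits need no side conditions. `lowerBy`
carries the results back to extended reals.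

The lower bound `w̄ ≤ w^π(x)` holds for every policy: a linear bound on the partial sums of a
nonnegative series bounds its normalized discounted sums (`ENNReal.one_sub_mul_tsum_le`), hence
`limsup (1 - α) v_α^π(x) ≤ w^π(x)`, and `m_α ≤ v_α^π(x)`. In particular `w^* < ∞` makes `w̄` and the
`m_α` finite.

The upper bound comes from the inequality (1). A nearly optimal discounted policy has a first action
`b` with `c(x, b) + α ∫ u_α dq ≤ u_α(x) + (1 - α) m_α + ε` (`exists_raisedCost_add_le`). No
measurability of `v_α` is required, because the integral may be read as a lower integral. Along a
sequence `(α_n, y_n)` that realizes the lower limit `u(x)`, Assumption (W*) supplies a limit action,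
and Fatou's lemma for weakly converging measures and varying integrands
(`lintegral_le_liminf_of_tendsto_integral`) gives `inf_b [c(x, b) + ∫ u dq] ≤ w̄ + u(x)`; this is
`iInf_le_raisedBar_add`.

Since `u` is lower semicontinuous, `c + ∫ u dq` is inf-compact in the action, locally uniformly in
the state. The infimum is thus attained, and a measurable minimizer exists by
Kuratowski–Ryll-Nardzewski selection (`SeqInfCompact.exists_measurable_argmin`). Iterating (1) along
a stationary policy `φ` yields `v_N^φ ≤ N w̄ + u`; as `u` is finite, `w^φ ≤ w̄`, and all the
quantities in (2) coincide. -/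

/-! ### Extended-real integrals and sums as differences -/

section ExtendedReal

theorem extIntegral_congr_ae {Ω : Type*} [MeasurableSpace Ω] {μ : Measure Ω} {f g : Ω → EReal}
    (h : f =ᵐ[μ] g) : extIntegral μ f = extIntegral μ g := by
  have h1 : (fun ω => (f ω).toENNReal) =ᵐ[μ] fun ω => (g ω).toENNReal :=
    h.mono fun ω hω => congrArg EReal.toENNReal hω
  have h2 : (fun ω => (-f ω).toENNReal) =ᵐ[μ] fun ω => (-g ω).toENNReal :=
    h.mono fun ω hω => congrArg (fun e : EReal => (-e).toENNReal) hω
  rw [extIntegral, extIntegral, lintegral_congr_ae h1, lintegral_congr_ae h2]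

theorem extIntegral_of_nonneg {Ω : Type*} [MeasurableSpace Ω] (μ : Measure Ω) {f : Ω → EReal}
    (h : ∀ ω, 0 ≤ f ω) : extIntegral μ f = ((∫⁻ ω, (f ω).toENNReal ∂μ : ℝ≥0∞) : EReal) := by
  have h0 : ∀ ω, (-f ω).toENNReal = 0 := fun ω =>
    EReal.toENNReal_of_nonpos (by simpa using h ω)
  simp [extIntegral, h0]

/-- The truncated differences satisfy `(g - h) + h = max g h = (h - g) + g`. Integrating this
identity and cancelling the finite terms gives the claim, also when `g` has infinite integral. -/
theorem extIntegral_coe_sub_coe {Ω : Type*} [MeasurableSpace Ω] (μ : Measure Ω)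
    {g h : Ω → ℝ≥0∞} (hg : Measurable g) (hh : Measurable h) (hfin : ∀ ω, h ω ≠ ⊤)
    (hint : ∫⁻ ω, h ω ∂μ ≠ ⊤) :
    extIntegral μ (fun ω => (g ω : EReal) - (h ω : EReal))
      = ((∫⁻ ω, g ω ∂μ : ℝ≥0∞) : EReal) - ((∫⁻ ω, h ω ∂μ : ℝ≥0∞) : EReal) := by
  have h1 : ∀ ω, ((g ω : EReal) - (h ω : EReal)).toENNReal = g ω - h ω := fun ω => by
    rw [EReal.toENNReal_sub (EReal.coe_ennreal_nonneg _)]; simp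
  have h2 : ∀ ω, (-((g ω : EReal) - (h ω : EReal))).toENNReal = h ω - g ω := fun ω => by
    rw [EReal.neg_sub (Or.inr (by simp)) (Or.inr (by simpa using hfin ω)),
      add_comm, ← sub_eq_add_neg, EReal.toENNReal_sub (EReal.coe_ennreal_nonneg _)]; simp
  unfold extIntegral
  simp_rw [h1, h2]
  have hle : ∫⁻ ω, (h ω - g ω) ∂μ ≤ ∫⁻ ω, h ω ∂μ := lintegral_mono fun ω => tsub_le_self
  have key : ∫⁻ ω, (g ω - h ω) ∂μ + ∫⁻ ω, h ω ∂μ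
      = ∫⁻ ω, (h ω - g ω) ∂μ + ∫⁻ ω, g ω ∂μ := by
    rw [← lintegral_add_right _ hh, ← lintegral_add_right _ hg]
    exact lintegral_congr fun ω => by rw [tsub_add_eq_max, tsub_add_eq_max, max_comm]
  generalize ∫⁻ ω, (g ω - h ω) ∂μ = a at *
  generalize ∫⁻ ω, (h ω - g ω) ∂μ = b at *
  generalize ∫⁻ ω, g ω ∂μ = c at *
  generalize ∫⁻ ω, h ω ∂μ = d at *
  lift d to NNReal using hint
  lift b to NNReal using (hle.trans_lt ENNReal.coe_lt_top).ne
  induction a with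
  | top =>
    have : c = ⊤ := by
      rw [top_add] at key
      by_contra hc
      exact ENNReal.add_ne_top.2 ⟨ENNReal.coe_ne_top, hc⟩ key.symm
    subst this
    rfl
  | coe a =>
    have : c ≠ ⊤ := by
      rintro rfl
      rw [add_top] at key
      exact ENNReal.add_ne_top.2 ⟨ENNReal.coe_ne_top, ENNReal.coe_ne_top⟩ key
    lift c to NNReal using this
    have key' : (a : ℝ) + d = b + c := by exact_mod_cast key
    have : (a : ℝ) - b = c - d := by linarith
    simp only [EReal.coe_nnreal_eq_coe_real]
    exact_mod_cast congrArg (fun r : ℝ => (r : EReal)) this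

theorem extSum_eq_extIntegral_count (f : ℕ → EReal) : extSum f = extIntegral Measure.count f := by
  simp [extSum, extIntegral, lintegral_count]

theorem ENNReal.add_liminf_le {ι : Type*} {l : Filter ι} (f g : ι → ℝ≥0∞) :
    liminf f l + liminf g l ≤ liminf (fun i => f i + g i) l := by
  rcases eq_or_neBot l with rfl | _
  · simp [liminf_eq]
  rcases eq_or_ne (liminf f l) 0 with hf | hf
  · rw [hf, zero_add]
    exact liminf_le_liminf (Eventually.of_forall fun i => le_add_self)
  rcases eq_or_ne (liminf g l) 0 with hg | hg
  · rw [hg, add_zero]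
    exact liminf_le_liminf (Eventually.of_forall fun i => le_self_add)
  refine le_of_forall_lt_imp_le_of_dense fun b hb => ?_
  obtain ⟨y, hy, z, hz, hb⟩ := ENNReal.exists_lt_add_of_lt_add hb hf hg
  refine le_liminf_of_le (by isBoundedDefault) ?_
  filter_upwards [eventually_lt_of_lt_liminf hy, eventually_lt_of_lt_liminf hz] with i h1 h2
  exact hb.le.trans (add_le_add h1.le h2.le)

end ExtendedReal

/-! ### Abelian comparison of discounted and average sums -/

section Tauberian

/-- Summation by parts: exchange the order of the double sum over `n ≤ m` and sum the geometric tail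
from `n` on. -/
theorem ENNReal.one_sub_mul_tsum_mul (r : ℝ≥0∞) (hr : r < 1) (a : ℕ → ℝ≥0∞) :
    ∑' n, r ^ n * a n = (1 - r) * ∑' m, r ^ m * ∑ n ∈ Finset.range (m + 1), a n := by
  have h1 : (1 - r) * (1 - r)⁻¹ = 1 :=
    ENNReal.mul_inv_cancel (tsub_pos_of_lt hr).ne' (ENNReal.sub_ne_top ENNReal.one_ne_top)
  have h2 : ∀ m, r ^ m * ∑ n ∈ Finset.range (m + 1), a n
      = ∑' n, if n ≤ m then r ^ m * a n else 0 := fun m => by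
    rw [tsum_eq_sum (s := Finset.range (m + 1)) (fun n hn => by
      rw [if_neg]; simpa [Nat.lt_succ_iff] using hn), Finset.mul_sum]
    refine Finset.sum_congr rfl fun n hn => ?_
    rw [if_pos (Nat.lt_succ_iff.1 (Finset.mem_range.1 hn))]
  have h3 : ∀ n, ∑' m, (if n ≤ m then r ^ m * a n else 0) = r ^ n * a n * (1 - r)⁻¹ := fun n => by
    rw [← ENNReal.summable.sum_add_tsum_nat_add' (k := n)]
    rw [Finset.sum_eq_zero (fun m hm => if_neg (by simpa using hm)), zero_add,
      ← ENNReal.tsum_geometric, ← ENNReal.tsum_mul_left]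
    refine tsum_congr fun m => ?_
    rw [if_pos (Nat.le_add_left _ _), pow_add]
    ring
  simp_rw [h2]
  rw [ENNReal.tsum_comm]
  simp_rw [h3]
  rw [ENNReal.tsum_mul_right, mul_comm, mul_assoc, mul_comm _ (1 - r), h1, mul_one]

theorem ENNReal.one_sub_mul_tsum_le (r : ℝ≥0∞) (hr : r < 1) (a : ℕ → ℝ≥0∞) (C b : ℝ≥0∞)
    (h : ∀ N, ∑ n ∈ Finset.range N, a n ≤ C + N * b) :
    (1 - r) * ∑' n, r ^ n * a n ≤ (1 - r) * C + b := by
  have h1 : (1 - r) * (1 - r)⁻¹ = 1 :=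
    ENNReal.mul_inv_cancel (tsub_pos_of_lt hr).ne' (ENNReal.sub_ne_top ENNReal.one_ne_top)
  -- With all terms equal to 1, the same identity evaluates `∑ (m + 1) r ^ m`.
  have h2 := ENNReal.one_sub_mul_tsum_mul r hr (fun _ => 1)
  simp only [mul_one, Finset.sum_const, Finset.card_range, nsmul_eq_mul,
    ENNReal.tsum_geometric] at h2
  rw [ENNReal.one_sub_mul_tsum_mul r hr a]
  calc (1 - r) * ((1 - r) * ∑' m, r ^ m * ∑ n ∈ Finset.range (m + 1), a n)
      ≤ (1 - r) * ((1 - r) * ∑' m, r ^ m * (C + ((m + 1 : ℕ) : ℝ≥0∞) * b)) := by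
        gcongr with m; exact h _
    _ = (1 - r) * ((1 - r) * (1 - r)⁻¹ * C
          + ((1 - r) * ∑' m, r ^ m * ((m + 1 : ℕ) : ℝ≥0∞)) * b) := by
        congr 1
        rw [mul_assoc, mul_assoc, ← mul_add, ← ENNReal.tsum_geometric, ← ENNReal.tsum_mul_right,
          ← ENNReal.tsum_mul_right, ← ENNReal.tsum_add]
        congr 2
        funext m
        ring
    _ = (1 - r) * C + b := by
        rw [← h2, h1, one_mul, mul_add, ← mul_assoc, h1, one_mul]

theorem ENNReal.exists_sum_range_le_of_limsup_lt (a : ℕ → ℝ≥0∞) {b : ℝ≥0∞}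
    (h : limsup (fun N : ℕ => (N : ℝ≥0∞)⁻¹ * ∑ n ∈ Finset.range N, a n) atTop < b)
    (hb : b ≠ ⊤) :
    ∃ C : ℝ≥0∞, C ≠ ⊤ ∧ ∀ N, ∑ n ∈ Finset.range N, a n ≤ C + N * b := by
  obtain ⟨N₀, hN₀⟩ := eventually_atTop.1 (eventually_lt_of_limsup_lt h)
  -- The shift by one excludes `N = 0`, where division by `N` is not available. The finitely many
  -- smaller `N` are absorbed in the constant.
  have hN : ∀ N ≥ N₀ + 1, ∑ n ∈ Finset.range N, a n ≤ N * b := fun N hN => by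
    have h0 : (N : ℝ≥0∞) ≠ 0 := by simpa using (by omega : N ≠ 0)
    have := (hN₀ N (by omega)).le
    rwa [mul_comm, ← div_eq_mul_inv, ENNReal.div_le_iff h0 (ENNReal.natCast_ne_top N),
      mul_comm] at this
  refine ⟨∑ n ∈ Finset.range (N₀ + 1), a n, ?_, fun N => ?_⟩
  · exact ((hN _ le_rfl).trans_lt (ENNReal.mul_lt_top (ENNReal.natCast_lt_top _) hb.lt_top)).ne
  · rcases le_total N (N₀ + 1) with h' | h'
    · exact (Finset.sum_le_sum_of_subset (Finset.range_mono h')).trans le_self_add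
    · exact (hN N h').trans le_add_self

end Tauberian

/-! ### Lower semicontinuity and Fatou's lemma under weak convergence -/

section Semicontinuity

theorem lowerSemicontinuous_liminf_prod_nhds {ι S γ : Type*} [TopologicalSpace S]
    [CompleteLinearOrder γ] [DenselyOrdered γ] (l : Filter ι) (f : ι × S → γ) :
    LowerSemicontinuous fun x => liminf f (l ×ˢ 𝓝 x) := by
  intro x b hb
  obtain ⟨c, hbc, hc⟩ := exists_between hb
  obtain ⟨s, hs, t, ht, hst⟩ := mem_prod_iff.1 (eventually_lt_of_lt_liminf hc)
  filter_upwards [eventually_mem_nhds_iff.2 ht] with y hy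
  refine hbc.trans_le (le_liminf_of_le (by isBoundedDefault) ?_)
  filter_upwards [prod_mem_prod hs hy] with p hp
  exact (hst hp).le

/-- The superlevel sets of `f` are open, so the layer-cake formula and Fatou's lemma in the level
variable apply to the truncations of `f`; monotone convergence removes the truncation. -/
theorem lintegral_le_liminf_of_forall_isOpen {S : Type*} [MeasurableSpace S] [TopologicalSpace S]
    [OpensMeasurableSpace S] {μ : Measure S} {μs : ℕ → Measure S}
    (h : ∀ G, IsOpen G → μ G ≤ liminf (fun i => μs i G) atTop)
    {f : S → ℝ≥0∞} (hf : LowerSemicontinuous f) :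
    ∫⁻ x, f x ∂μ ≤ liminf (fun i => ∫⁻ x, f x ∂(μs i)) atTop := by
  have hbdd : ∀ k : ℕ, ∫⁻ x, min (f x) k ∂μ
      ≤ liminf (fun i => ∫⁻ x, min (f x) k ∂(μs i)) atTop := by
    intro k
    have hfin : ∀ x, min (f x) (k : ℝ≥0∞) ≠ ⊤ := fun x =>
      ((min_le_right _ _).trans_lt (ENNReal.natCast_lt_top k)).ne
    have hmeas : Measurable fun x => (min (f x) (k : ℝ≥0∞)).toReal :=
      (hf.measurable.min measurable_const).ennreal_toReal
    have hopen : ∀ t : ℝ, 0 < t → IsOpen {x | t < (min (f x) (k : ℝ≥0∞)).toReal} := fun t ht => by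
      have : {x | t < (min (f x) (k : ℝ≥0∞)).toReal}
          = {x | ENNReal.ofReal t < f x} ∩ {x | ENNReal.ofReal t < k} := by
        ext x
        simp only [Set.mem_ofPred_eq, Set.mem_inter_iff]
        rw [← ENNReal.ofReal_lt_iff_lt_toReal ht.le (hfin x), lt_min_iff]
      rw [this]
      exact (hf.isOpen_preimage _).inter isOpen_const
    have hcoe : ∀ x, min (f x) (k : ℝ≥0∞) = ENNReal.ofReal (min (f x) (k : ℝ≥0∞)).toReal :=
      fun x => (ENNReal.ofReal_toReal (hfin x)).symm
    have hlc : ∀ ν : Measure S, ∫⁻ x, min (f x) (k : ℝ≥0∞) ∂ν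
        = ∫⁻ t in Set.Ioi (0 : ℝ), ν {x | t < (min (f x) (k : ℝ≥0∞)).toReal} := fun ν => by
      rw [← lintegral_eq_lintegral_meas_lt ν (Eventually.of_forall fun x => ENNReal.toReal_nonneg)
        hmeas.aemeasurable]
      exact lintegral_congr hcoe
    simp_rw [hlc]
    refine (setLIntegral_mono' measurableSet_Ioi fun t ht => h _ (hopen t ht)).trans ?_
    exact lintegral_liminf_le fun n => Antitone.measurable fun s t hst =>
      measure_mono fun x hx => lt_of_le_of_lt hst hx
  have hsup : ∀ x, f x = ⨆ k : ℕ, min (f x) (k : ℝ≥0∞) := fun x => by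
    have : ⨆ k : ℕ, min (f x) (k : ℝ≥0∞) = min (f x) (⨆ k : ℕ, (k : ℝ≥0∞)) :=
      (inf_iSup_eq _ _).symm
    rw [this, ENNReal.iSup_natCast, min_eq_left le_top]
  have hmono : Monotone fun (k : ℕ) x => min (f x) (k : ℝ≥0∞) := fun i j hij x =>
    min_le_min_left _ (by exact_mod_cast hij)
  calc ∫⁻ x, f x ∂μ = ∫⁻ x, ⨆ k : ℕ, min (f x) (k : ℝ≥0∞) ∂μ := lintegral_congr hsup
    _ = ⨆ k : ℕ, ∫⁻ x, min (f x) (k : ℝ≥0∞) ∂μ :=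
        lintegral_iSup (fun k => hf.measurable.min measurable_const) hmono
    _ ≤ _ := iSup_le fun k => (hbdd k).trans
        (liminf_le_liminf (Eventually.of_forall fun i => lintegral_mono fun x => min_le_left _ _))

/-- Fatou's lemma for weakly converging probabilities and varying integrands, which need not be
measurable. -/
theorem lintegral_le_liminf_of_tendsto_integral {S : Type*} [MeasurableSpace S]
    [TopologicalSpace S] [OpensMeasurableSpace S] [HasOuterApproxClosed S]
    {μ : Measure S} [IsProbabilityMeasure μ] {μs : ℕ → Measure S}
    [∀ n, IsProbabilityMeasure (μs n)]
    (h : ∀ f : S →ᵇ ℝ, Tendsto (fun n => ∫ z, f z ∂(μs n)) atTop (𝓝 (∫ z, f z ∂μ)))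
    {f : ℕ → S → ℝ≥0∞} {g : S → ℝ≥0∞}
    (hg : ∀ y, g y ≤ liminf (fun p : ℕ × S => f p.1 p.2) (atTop ×ˢ 𝓝 y)) :
    ∫⁻ y, g y ∂μ ≤ liminf (fun n => ∫⁻ y, f n y ∂(μs n)) atTop := by
  have hopen : ∀ G, IsOpen G → μ G ≤ liminf (fun i => μs i G) atTop := by
    intro G hG
    let P : ProbabilityMeasure S := ⟨μ, inferInstance⟩
    let Ps : ℕ → ProbabilityMeasure S := fun n => ⟨μs n, inferInstance⟩
    have hP : Tendsto Ps atTop (𝓝 P) :=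
      ProbabilityMeasure.tendsto_iff_forall_integral_tendsto.2 h
    exact ProbabilityMeasure.le_liminf_measure_open_of_tendsto hP hG
  -- `G k` is the lower semicontinuous envelope of `inf_{n ≥ k} f n`. It lies below `f n` for `n ≥
  -- k`, increases in `k`, and its supremum dominates `g`, so the case of a fixed semicontinuous
  -- integrand suffices.
  let G : ℕ → S → ℝ≥0∞ := fun k y => liminf (fun p : ℕ × S => f p.1 p.2) (𝓟 (Set.Ici k) ×ˢ 𝓝 y)
  have hGlsc : ∀ k, LowerSemicontinuous (G k) := fun k => lowerSemicontinuous_liminf_prod_nhds _ _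
  have hGle : ∀ k n, k ≤ n → ∀ y, G k y ≤ f n y := by
    intro k n hkn y
    refine liminf_le_of_frequently_le ?_ (by isBoundedDefault)
    refine fun hev => ?_
    obtain ⟨s, hs, t, ht, hst⟩ := mem_prod_iff.1 hev
    exact hst (Set.mk_mem_prod (mem_principal.1 hs hkn) (mem_of_mem_nhds ht)) le_rfl
  have hGmono : Monotone G := fun i j hij y =>
    liminf_le_liminf_of_le (prod_mono_left _ (principal_mono.2 (Set.Ici_subset_Ici.2 hij)))
  have hgG : ∀ y, g y ≤ ⨆ k, G k y := by
    intro y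
    refine le_of_forall_lt_imp_le_of_dense fun b hb => ?_
    obtain ⟨s, hs, t, ht, hst⟩ := mem_prod_iff.1 (eventually_lt_of_lt_liminf (hb.trans_le (hg y)))
    obtain ⟨k, hk⟩ := mem_atTop_sets.1 hs
    refine le_iSup_of_le k (le_liminf_of_le (by isBoundedDefault) ?_)
    filter_upwards [prod_mem_prod (mem_principal_self (Set.Ici k)) ht] with p hp
    exact le_of_lt (hst (Set.mk_mem_prod (hk _ hp.1) hp.2))
  calc ∫⁻ y, g y ∂μ ≤ ∫⁻ y, ⨆ k, G k y ∂μ := lintegral_mono hgG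
    _ = ⨆ k, ∫⁻ y, G k y ∂μ := lintegral_iSup (fun k => (hGlsc k).measurable) hGmono
    _ ≤ _ := iSup_le fun k => (lintegral_le_liminf_of_forall_isOpen hopen (hGlsc k)).trans
        (liminf_le_liminf ((eventually_ge_atTop k).mono fun n hn => lintegral_mono (hGle k n hn)))

end Semicontinuity

/-! ### Measurable selection for compact-valued multifunctions -/

section Selection

/-- A multifunction with nonempty compact values for which the preimages of closed sets are
measurable. -/
structure IsMeasurableCompactMap {S Y : Type*} [MeasurableSpace S] [TopologicalSpace Y]
    (Γ : S → Set Y) : Prop where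
  isCompact : ∀ s, IsCompact (Γ s)
  nonempty : ∀ s, (Γ s).Nonempty
  measurableSet : ∀ F : Set Y, IsClosed F → MeasurableSet {s | (Γ s ∩ F).Nonempty}

/-- Intersect `Γ s` with the first ball, in a countable cover by closed balls of radius `r`, that
meets it. The index of that ball depends measurably on `s`, since the balls are closed. -/
theorem IsMeasurableCompactMap.exists_small {S Y : Type*} [MeasurableSpace S] [MetricSpace Y]
    [SecondCountableTopology Y] {Γ : S → Set Y} (hΓ : IsMeasurableCompactMap Γ) {r : ℝ}
    (hr : 0 < r) :
    ∃ Γ' : S → Set Y, IsMeasurableCompactMap Γ' ∧ (∀ s, Γ' s ⊆ Γ s) ∧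
      ∀ s, ∀ y ∈ Γ' s, ∀ z ∈ Γ' s, dist y z ≤ r + r := by
  classical
  rcases isEmpty_or_nonempty Y with hY | hY
  · exact ⟨Γ, hΓ, fun s => subset_rfl, fun s y => (hY.false y).elim⟩
  let d := TopologicalSpace.denseSeq Y
  have hex : ∀ s, ∃ j, (Γ s ∩ Metric.closedBall (d j) r).Nonempty := fun s => by
    obtain ⟨y, hy⟩ := hΓ.nonempty s
    obtain ⟨j, hj⟩ := (TopologicalSpace.denseRange_denseSeq Y).exists_dist_lt y hr
    exact ⟨j, y, hy, hj.le⟩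
  refine ⟨fun s => Γ s ∩ Metric.closedBall (d (Nat.find (hex s))) r, ⟨fun s => ?_, fun s => ?_,
    fun F hF => ?_⟩, fun s => Set.inter_subset_left, fun s y hy z hz => ?_⟩
  · exact (hΓ.isCompact s).inter_right Metric.isClosed_closedBall
  · exact Nat.find_spec (hex s)
  · have hj : ∀ j, MeasurableSet {s | Nat.find (hex s) = j} := fun j => by
      have : {s | Nat.find (hex s) = j} = {s | (Γ s ∩ Metric.closedBall (d j) r).Nonempty} ∩
          ⋂ i ∈ Set.Iio j, {s | (Γ s ∩ Metric.closedBall (d i) r).Nonempty}ᶜ := by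
        ext s
        simp [Nat.find_eq_iff]
      rw [this]
      exact (hΓ.measurableSet _ Metric.isClosed_closedBall).inter
        (MeasurableSet.biInter (Set.to_countable _) fun i _ =>
          (hΓ.measurableSet _ Metric.isClosed_closedBall).compl)
    have : {s | (Γ s ∩ Metric.closedBall (d (Nat.find (hex s))) r ∩ F).Nonempty}
        = ⋃ j, {s | Nat.find (hex s) = j} ∩
          {s | (Γ s ∩ (Metric.closedBall (d j) r ∩ F)).Nonempty} := by
      ext s
      simp [Set.inter_assoc]
    rw [this]
    exact MeasurableSet.iUnion fun j => (hj j).inter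
      (hΓ.measurableSet _ (Metric.isClosed_closedBall.inter hF))
  · exact (dist_triangle_right y z _).trans (add_le_add hy.2 hz.2)

/-- The Kuratowski–Ryll-Nardzewski selection theorem for compact-valued multifunctions. -/
theorem IsMeasurableCompactMap.exists_measurable_selector {S Y : Type*} [MeasurableSpace S]
    [TopologicalSpace Y] [TopologicalSpace.MetrizableSpace Y] [SecondCountableTopology Y]
    [MeasurableSpace Y] [BorelSpace Y] {Γ : S → Set Y} (hΓ : IsMeasurableCompactMap Γ) :
    ∃ f : S → Y, Measurable f ∧ ∀ s, f s ∈ Γ s := by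
  let := TopologicalSpace.metrizableSpaceMetric Y
  have hstep : ∀ (k : ℕ) (Δ : {Δ : S → Set Y // IsMeasurableCompactMap Δ}),
      ∃ Δ' : {Δ : S → Set Y // IsMeasurableCompactMap Δ}, (∀ s, Δ'.1 s ⊆ Δ.1 s) ∧
        ∀ s, ∀ y ∈ Δ'.1 s, ∀ z ∈ Δ'.1 s, dist y z ≤ (1 / 2) ^ k + (1 / 2) ^ k := fun k Δ => by
    obtain ⟨Δ', h1, h2, h3⟩ := Δ.2.exists_small (r := (1 / 2) ^ k) (by positivity)
    exact ⟨⟨Δ', h1⟩, h2, h3⟩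
  choose next hsub hdist using hstep
  let Δ : ℕ → {Δ : S → Set Y // IsMeasurableCompactMap Δ} :=
    fun n => Nat.rec ⟨Γ, hΓ⟩ (fun k D => next k D) n
  have hint : ∀ s, ∀ F : Set Y, IsClosed F → (∀ k, ((Δ k).1 s ∩ F).Nonempty) →
      (⋂ k, (Δ k).1 s ∩ F).Nonempty := fun s F hF hne =>
    IsCompact.nonempty_iInter_of_sequence_nonempty_isCompact_isClosed _
      (fun k => Set.inter_subset_inter_left _ (hsub k (Δ k) s)) hne
      (((Δ 0).2.isCompact s).inter_right hF) fun k => ((Δ k).2.isCompact s).isClosed.inter hF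
  have hex : ∀ s, ∃ y, ∀ k, y ∈ (Δ k).1 s := fun s => by
    obtain ⟨y, hy⟩ := hint s Set.univ isClosed_univ fun k => by
      simpa using (Δ k).2.nonempty s
    exact ⟨y, fun k => (Set.mem_iInter.1 hy k).1⟩
  choose f hf using hex
  refine ⟨f, measurable_of_isClosed fun F hF => ?_, fun s => hf s 0⟩
  -- If every shrunken set meets `F`, compactness gives a common point in `F`. Since the diameters
  -- tend to 0, that point is `f s`.
  have : f ⁻¹' F = ⋂ k, {s | ((Δ k).1 s ∩ F).Nonempty} := by
    ext s
    simp only [Set.mem_preimage, Set.mem_iInter, Set.mem_ofPred_eq]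
    refine ⟨fun h k => ⟨f s, hf s k, h⟩, fun h => ?_⟩
    obtain ⟨y, hy⟩ := hint s F hF h
    have hy' := fun k => Set.mem_iInter.1 hy k
    have h0 : Tendsto (fun k : ℕ => ((1 : ℝ) / 2) ^ k + (1 / 2) ^ k) atTop (𝓝 (0 + 0)) :=
      (tendsto_pow_atTop_nhds_zero_of_lt_one (by norm_num) (by norm_num)).add
        (tendsto_pow_atTop_nhds_zero_of_lt_one (by norm_num) (by norm_num))
    have hle : dist (f s) y ≤ 0 + 0 := ge_of_tendsto' h0 fun k =>
      hdist k (Δ k) s _ (hf s (k + 1)) _ (hy' (k + 1)).1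
    have : f s = y := dist_le_zero.1 (by simpa using hle)
    exact this ▸ (hy' 0).2
  rw [this]
  exact MeasurableSet.iInter fun k => (Δ k).2.measurableSet F hF

end Selection

/-! ### Attainment and measurable choice of minimizers -/

section Argmin

/-- Sequential form of joint lower semicontinuity and inf-compactness in the second variable,
locally uniformly in the first one, of a function on the graph of `D`. -/
def SeqInfCompact {S Y : Type*} [TopologicalSpace S] [TopologicalSpace Y] (D : S → Set Y)
    (h : S → Y → ℝ≥0∞) : Prop :=
  ∀ (x : ℕ → S) (x₀ : S) (a : ℕ → Y) (C : ℝ≥0∞), C ≠ ⊤ → Tendsto x atTop (𝓝 x₀) →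
    (∀ n, a n ∈ D (x n)) → (∀ n, h (x n) (a n) ≤ C) →
    ∃ a₀ ∈ D x₀, MapClusterPt a₀ atTop a ∧ h x₀ a₀ ≤ C

variable {S Y : Type*} [TopologicalSpace S] [TopologicalSpace Y] {D : S → Set Y}
  {h : S → Y → ℝ≥0∞}

theorem SeqInfCompact.inter (H : SeqInfCompact D h) {F : Set Y} (hF : IsClosed F) :
    SeqInfCompact (fun x => D x ∩ F) h := by
  intro x x₀ a C hC hx ha hle
  obtain ⟨a₀, h1, h2, h3⟩ := H x x₀ a C hC hx (fun n => (ha n).1) hle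
  refine ⟨a₀, ⟨h1, ?_⟩, h2, h3⟩
  exact hF.mem_of_mapClusterPt h2 (Eventually.of_forall fun n => (ha n).2)

variable [TopologicalSpace.MetrizableSpace Y]

theorem SeqInfCompact.isCompact (H : SeqInfCompact D h) (x : S) {C : ℝ≥0∞} (hC : C ≠ ⊤) :
    IsCompact {a | a ∈ D x ∧ h x a ≤ C} := by
  let := TopologicalSpace.metrizableSpaceMetric Y
  refine IsSeqCompact.isCompact fun a ha => ?_
  obtain ⟨a₀, h1, h2, h3⟩ := H (fun _ => x) x a C hC tendsto_const_nhds (fun n => (ha n).1)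
    fun n => (ha n).2
  exact ⟨a₀, ⟨h1, h3⟩, h2.tendsto_subseq⟩

/-- The level sets at heights `C + 1/(n + 1)` are nested nonempty compacts; a common point has value
at most `C`. -/
theorem SeqInfCompact.iInf_le_iff (H : SeqInfCompact D h) (x : S) {C : ℝ≥0∞} (hC : C ≠ ⊤) :
    (⨅ a ∈ D x, h x a) ≤ C ↔ ∃ a ∈ D x, h x a ≤ C := by
  refine ⟨fun hle => ?_, fun ⟨a, ha, hle⟩ => iInf₂_le_of_le a ha hle⟩
  have hlim : Tendsto (fun n : ℕ => C + ((n : ℝ≥0∞) + 1)⁻¹) atTop (𝓝 (C + 0)) := by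
    refine tendsto_const_nhds.add ?_
    have := (tendsto_add_atTop_iff_nat (f := fun n : ℕ => (n : ℝ≥0∞)⁻¹) 1).2
      ENNReal.tendsto_inv_nat_nhds_zero
    simpa using this
  have hfin : ∀ n : ℕ, C + ((n : ℝ≥0∞) + 1)⁻¹ ≠ ⊤ := fun n =>
    ENNReal.add_ne_top.2 ⟨hC, ENNReal.inv_ne_top.2 (by simp)⟩
  obtain ⟨a, ha⟩ := IsCompact.nonempty_iInter_of_sequence_nonempty_isCompact_isClosed
    (fun n : ℕ => {a | a ∈ D x ∧ h x a ≤ C + ((n : ℝ≥0∞) + 1)⁻¹})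
    (fun n a ha => ⟨ha.1, ha.2.trans (by gcongr; simp)⟩)
    (fun n => by
      have hlt : (⨅ a ∈ D x, h x a) < C + ((n : ℝ≥0∞) + 1)⁻¹ :=
        hle.trans_lt (ENNReal.lt_add_right hC (by simp))
      obtain ⟨a, ha, hlt⟩ := by simpa only [iInf_lt_iff] using hlt
      exact ⟨a, ha, hlt.le⟩)
    (H.isCompact x (hfin 0)) (fun n => (H.isCompact x (hfin n)).isClosed)
  have ha' := fun n => Set.mem_iInter.1 ha n
  exact ⟨a, (ha' 0).1, by simpa using ge_of_tendsto' hlim fun n => (ha' n).2⟩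

theorem SeqInfCompact.lowerSemicontinuous_iInf [FirstCountableTopology S]
    (H : SeqInfCompact D h) : LowerSemicontinuous fun x => ⨅ a ∈ D x, h x a := by
  rw [lowerSemicontinuous_iff_isClosed_preimage]
  intro C
  rcases eq_or_ne C ⊤ with rfl | hC
  · simp
  refine IsSeqClosed.isClosed fun x x₀ hx hx₀ => ?_
  choose a ha hle using fun n => (H.iInf_le_iff (x n) hC).1 (hx n)
  obtain ⟨a₀, h1, -, h3⟩ := H x x₀ a C hC hx₀ ha hle
  exact (H.iInf_le_iff x₀ hC).2 ⟨a₀, h1, h3⟩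

/-- The minimizers over `D x` meet a closed set `F` exactly when the minimum over `D x ∩ F` does not
exceed that over `D x`. Both minima are lower semicontinuous in `x`, so the set of such `x` is
measurable and the selection theorem applies. -/
theorem SeqInfCompact.exists_measurable_argmin [FirstCountableTopology S] [MeasurableSpace S]
    [OpensMeasurableSpace S] [SecondCountableTopology Y] [MeasurableSpace Y] [BorelSpace Y]
    (H : SeqInfCompact D h) (hfin : ∀ x, (⨅ a ∈ D x, h x a) ≠ ⊤) :
    ∃ f : S → Y, Measurable f ∧ ∀ x, f x ∈ D x ∧ h x (f x) = ⨅ a ∈ D x, h x a := by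
  obtain ⟨f, hf, hmem⟩ := IsMeasurableCompactMap.exists_measurable_selector
    (Γ := fun x => {a | a ∈ D x ∧ h x a ≤ ⨅ a ∈ D x, h x a}) ⟨fun x => H.isCompact x (hfin x),
      fun x => (H.iInf_le_iff x (hfin x)).1 le_rfl, fun F hF => by
      have : {x | ({a | a ∈ D x ∧ h x a ≤ ⨅ a ∈ D x, h x a} ∩ F).Nonempty}
          = {x | (⨅ a ∈ D x ∩ F, h x a) ≤ ⨅ a ∈ D x, h x a} := by
        ext x
        refine Iff.trans ?_ ((H.inter hF).iInf_le_iff x (hfin x)).symm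
        exact ⟨fun ⟨a, ⟨h1, h2⟩, h3⟩ => ⟨a, ⟨h1, h3⟩, h2⟩,
          fun ⟨a, ⟨h1, h3⟩, h2⟩ => ⟨a, ⟨h1, h2⟩, h3⟩⟩
      rw [this]
      exact measurableSet_le (H.inter hF).lowerSemicontinuous_iInf.measurable
        H.lowerSemicontinuous_iInf.measurable⟩
  exact ⟨f, hf, fun x => ⟨(hmem x).1, le_antisymm (hmem x).2 (iInf₂_le _ (hmem x).1)⟩⟩

end Argmin

/-! ### Laws of trajectories and their shifts -/

section Trajectories

open Preorder

variable {Y : Type*} [MeasurableSpace Y]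

/-- A law on trajectories is determined by its initial distribution and its transitions. -/
theorem eq_trajMeasure_of_map_compProd {μ : Measure (ℕ → Y)} [IsProbabilityMeasure μ]
    (μ₀ : Measure Y) [IsProbabilityMeasure μ₀]
    (κ : (n : ℕ) → Kernel ((i : Finset.Iic n) → Y) Y) [∀ n, IsMarkovKernel (κ n)]
    (h0 : μ.map (fun ω => ω 0) = μ₀)
    (hs : ∀ n, μ.map (frestrictLe (π := fun _ => Y) n) ⊗ₘ κ n
      = μ.map fun ω => (frestrictLe (π := fun _ => Y) n ω, ω (n + 1))) :
    μ = Kernel.trajMeasure (X := fun _ => Y) μ₀ κ := by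
  set ν := Kernel.trajMeasure (X := fun _ => Y) μ₀ κ with hν
  -- Initial segments have the same law by induction; every finite set of times lies in such a
  -- segment, and finite marginals determine the measure.
  have hm : ∀ n, μ.map (frestrictLe (π := fun _ => Y) n)
      = ν.map (frestrictLe (π := fun _ => Y) n) := by
    intro n
    induction n with
    | zero =>
      rw [hν, Kernel.trajMeasure, Measure.map_comp _ _ (by fun_prop), Kernel.traj_map_frestrictLe,
        Kernel.partialTraj_self, Measure.id_comp, ← h0, Measure.map_map (by fun_prop) (by fun_prop)]
      congr 1
      funext ω i
      obtain ⟨i, hi⟩ := i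
      obtain rfl : i = 0 := Nat.le_zero.1 (Finset.mem_Iic.1 hi)
      rfl
    | succ n ih =>
      let g : ((i : Finset.Iic n) → Y) × Y → ((i : Finset.Iic (n + 1)) → Y) := fun p i =>
        if hi : (i : ℕ) ≤ n then p.1 ⟨i, Finset.mem_Iic.2 hi⟩ else p.2
      have hg : Measurable g := by
        refine measurable_pi_iff.2 fun i => ?_
        by_cases hi : (i : ℕ) ≤ n
        · simp only [g, hi, dif_pos]
          fun_prop
        · simp only [g, hi, dif_neg, not_false_eq_true]
          fun_prop
      have hcomp : frestrictLe (π := fun _ => Y) (n + 1)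
          = g ∘ fun ω : ℕ → Y => (frestrictLe (π := fun _ => Y) n ω, ω (n + 1)) := by
        funext ω i
        obtain ⟨i, hi⟩ := i
        by_cases h : i ≤ n
        · simp [g, h]
        · obtain rfl : i = n + 1 := le_antisymm (Finset.mem_Iic.1 hi) (by omega)
          simp [g]
      have hν' : ν.map (frestrictLe (π := fun _ => Y) n) ⊗ₘ κ n
          = ν.map fun ω => (frestrictLe (π := fun _ => Y) n ω, ω (n + 1)) :=
        Kernel.map_frestrictLe_trajMeasure_compProd_eq_map_trajMeasure
      rw [hcomp, ← Measure.map_map hg (by fun_prop), ← Measure.map_map hg (by fun_prop),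
        ← hs, ← hν', ih]
  refine IsProjectiveLimit.unique (P := fun I => ν.map I.restrict) (fun I => ?_) fun I => rfl
  have hI : I ⊆ Finset.Iic (I.sup id) := fun i hi => Finset.mem_Iic.2 (Finset.le_sup (f := id) hi)
  have hcomp : I.restrict (π := fun _ => Y)
      = Finset.restrict₂ (π := fun _ => Y) hI ∘ frestrictLe (π := fun _ => Y) (I.sup id) := rfl
  have hr : Measurable (Finset.restrict₂ (π := fun _ => Y) hI) := Finset.measurable_restrict₂ hI
  rw [hcomp, ← Measure.map_map hr (by fun_prop), hm, Measure.map_map hr (by fun_prop)]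
  rfl

theorem lintegral_trajMeasure (μ₀ : Measure Y)
    (κ : (n : ℕ) → Kernel ((i : Finset.Iic n) → Y) Y) [∀ n, IsMarkovKernel (κ n)]
    {F : (ℕ → Y) → ℝ≥0∞} (hF : Measurable F) :
    ∫⁻ ω, F ω ∂(Kernel.trajMeasure (X := fun _ => Y) μ₀ κ)
      = ∫⁻ y, ∫⁻ ω, F ω ∂(Kernel.traj (X := fun _ => Y) κ 0 (fun _ => y)) ∂μ₀ := by
  unfold Kernel.trajMeasure
  rw [Measure.lintegral_bind (Kernel.aemeasurable _) hF.aemeasurable, lintegral_map]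
  · rfl
  · exact hF.lintegral_kernel
  · fun_prop

/-- Prepend a point to a finite history. -/
def consIic {n : ℕ} (z : Y) (h : (i : Finset.Iic n) → Y) : (i : Finset.Iic (n + 1)) → Y
  | ⟨0, _⟩ => z
  | ⟨i + 1, hi⟩ => h ⟨i, Finset.mem_Iic.2 (Nat.succ_le_succ_iff.1 (Finset.mem_Iic.1 hi))⟩

theorem traj_zero_eq_trajMeasure_dirac (κ : (n : ℕ) → Kernel ((i : Finset.Iic n) → Y) Y)
    [∀ n, IsMarkovKernel (κ n)] (z : Y) :
    Kernel.traj (X := fun _ => Y) κ 0 (fun _ => z)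
      = Kernel.trajMeasure (X := fun _ => Y) (Measure.dirac z) κ := by
  unfold Kernel.trajMeasure
  rw [Measure.map_dirac' (by fun_prop), Measure.dirac_bind (Kernel.measurable _)]
  rfl

theorem ae_traj_zero_eq [MeasurableSingletonClass Y]
    (κ : (n : ℕ) → Kernel ((i : Finset.Iic n) → Y) Y)
    [∀ n, IsMarkovKernel (κ n)] (z : Y) :
    ∀ᵐ ω ∂(Kernel.traj (X := fun _ => Y) κ 0 (fun _ => z)), ω 0 = z := by
  have h := Kernel.traj_map_frestrictLe_apply (X := fun _ => Y) (κ := κ) 0 0 (fun _ => z)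
  rw [Kernel.partialTraj_self, Kernel.id_apply] at h
  have h2 := congrArg (fun μ => Measure.map
    (fun h : (i : Finset.Iic 0) → Y => h ⟨0, Finset.mem_Iic.2 le_rfl⟩) μ) h
  beta_reduce at h2
  rw [Measure.map_map (by fun_prop) (by fun_prop), Measure.map_dirac' (by fun_prop)] at h2
  have h3 : ∀ᵐ y ∂(Measure.dirac z), y = z := by simp [ae_dirac_eq]
  rw [← h2] at h3
  exact ae_of_ae_map (by fun_prop) h3

/-- The trajectory almost surely starts at `z`, so its history is `z` followed by the shifted
history. The shifted process therefore has transitions `κ'`, and these with its initial law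
determine its distribution. -/
theorem map_shift_traj [MeasurableSingletonClass Y]
    (κ κ' : (n : ℕ) → Kernel ((i : Finset.Iic n) → Y) Y)
    [∀ n, IsMarkovKernel (κ n)] [∀ n, IsMarkovKernel (κ' n)] (z : Y)
    (h : ∀ n w, κ' n w = κ (n + 1) (consIic z w)) :
    (Kernel.traj (X := fun _ => Y) κ 0 (fun _ => z)).map (fun ω n => ω (n + 1))
      = Kernel.trajMeasure (X := fun _ => Y) (κ 0 (fun _ => z)) κ' := by
  set Q := Kernel.traj (X := fun _ => Y) κ 0 (fun _ => z) with hQ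
  have hshift : Measurable fun (ω : ℕ → Y) (n : ℕ) => ω (n + 1) := by fun_prop
  have hrec : ∀ n, Q.map (frestrictLe (π := fun _ => Y) n) ⊗ₘ κ n
      = Q.map fun ω => (frestrictLe (π := fun _ => Y) n ω, ω (n + 1)) := fun n => by
    rw [hQ, traj_zero_eq_trajMeasure_dirac]
    exact Kernel.map_frestrictLe_trajMeasure_compProd_eq_map_trajMeasure
  have : IsProbabilityMeasure (Q.map (fun ω n => ω (n + 1))) :=
    Measure.isProbabilityMeasure_map hshift.aemeasurable
  refine eq_trajMeasure_of_map_compProd _ _ ?_ fun n => ?_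
  · rw [Measure.map_map (by fun_prop) hshift,
      ← Kernel.map_traj_succ_self (X := fun _ => Y) (κ := κ),
      Kernel.map_apply _ (by fun_prop)]
    rfl
  · let tail : ((i : Finset.Iic (n + 1)) → Y) → ((i : Finset.Iic n) → Y) := fun w i =>
      w ⟨i + 1, Finset.mem_Iic.2 (Nat.succ_le_succ (Finset.mem_Iic.1 i.2))⟩
    have htail : Measurable tail := by fun_prop
    have h1 := congrArg (fun μ => Measure.map (Prod.map tail id) μ) (hrec (n + 1))
    beta_reduce at h1
    rw [Measure.map_map (by fun_prop) (by fun_prop)] at h1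
    rw [Measure.map_map (by fun_prop) hshift, Measure.map_map (by fun_prop) hshift]
    refine Eq.trans ?_ h1
    ext s hs
    rw [Measure.map_apply (by fun_prop) hs, Measure.compProd_apply hs,
      Measure.compProd_apply (hs.preimage (by fun_prop)),
      lintegral_map (Kernel.measurable_kernel_prodMk_left hs) (by fun_prop),
      lintegral_map (Kernel.measurable_kernel_prodMk_left (hs.preimage (by fun_prop)))
        (by fun_prop)]
    refine lintegral_congr_ae ?_
    filter_upwards [ae_traj_zero_eq κ z] with ω hω
    have hc : frestrictLe (π := fun _ => Y) (n + 1) ω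
        = consIic z (frestrictLe (π := fun _ => Y) n fun k => ω (k + 1)) := by
      funext ⟨i, hi⟩
      cases i with
      | zero => exact hω
      | succ i => rfl
    simp only [Function.comp_apply]
    rw [h, ← hc]
    rfl

end Trajectories

/-! ### First-step analysis of policies -/

namespace MDP

variable {X A : Type*} [MeasurableSpace X] [MeasurableSpace A]

theorem measurableSet_actions (M : MDP X A) (x : X) : MeasurableSet (M.actions x) :=
  M.measurableSet_graph.preimage measurable_prodMk_left

theorem transKernel_apply (M : MDP X A) {p : X × A} (hp : p ∈ M.graph) :
    M.transKernel p = M.trans p :=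
  if_pos hp

theorem measurable_finCons (n : ℕ) (z : X × A) :
    Measurable fun h : (Fin n → X × A) × X => ((Fin.cons z h.1 : Fin (n + 1) → X × A), h.2) := by
  refine Measurable.prodMk (measurable_pi_iff.2 fun i => ?_) measurable_snd
  refine Fin.cases ?_ (fun j => ?_) i
  · simp only [Fin.cons_zero]
    fun_prop
  · simp only [Fin.cons_succ]
    fun_prop

/-- The policy that `π` induces after the first state-action pair `z` has been observed. -/
noncomputable def Policy.shift {M : MDP X A} (π : M.Policy) (z : X × A) : M.Policy where
  rule n := (π.rule (n + 1)).comap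
    (fun h : (Fin n → X × A) × X => ((Fin.cons z h.1 : Fin (n + 1) → X × A), h.2))
    (measurable_finCons n z)
  isMarkovKernel_rule n := by
    have := π.isMarkovKernel_rule (n + 1)
    infer_instance
  rule_actions n h := π.rule_actions (n + 1) _

theorem StationaryPolicy.shift_toPolicy {M : MDP X A} (φ : M.StationaryPolicy) (z : X × A) :
    φ.toPolicy.shift z = φ.toPolicy := by
  unfold Policy.shift StationaryPolicy.toPolicy
  congr 1

instance (M : MDP X A) (π : M.Policy) (x : X) : IsProbabilityMeasure (M.initialLaw π x) := by
  have := π.isMarkovKernel_rule 0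
  exact Measure.isProbabilityMeasure_map (by fun_prop)

instance (M : MDP X A) (π : M.Policy) (x : X) : IsProbabilityMeasure (M.pathMeasure π x) := by
  unfold pathMeasure
  infer_instance

/-- The law of the trajectory that starts with the state-action pair `z`. -/
noncomputable def pairMeasure (M : MDP X A) (π : M.Policy) (z : X × A) : Measure (ℕ → X × A) :=
  Kernel.traj (X := fun _ => X × A) (M.stepKernel π) 0 (fun _ => z)

theorem measurable_lintegral_pairMeasure (M : MDP X A) (π : M.Policy)
    {F : (ℕ → X × A) → ℝ≥0∞} (hF : Measurable F) :
    Measurable fun z => ∫⁻ ω, F ω ∂(M.pairMeasure π z) :=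
  (hF.lintegral_kernel (κ := Kernel.traj (X := fun _ => X × A) (M.stepKernel π) 0)).comp
    (measurable_pi_iff.2 fun _ => measurable_id)

theorem lintegral_pathMeasure (M : MDP X A) (π : M.Policy) (x : X)
    {F : (ℕ → X × A) → ℝ≥0∞} (hF : Measurable F) :
    ∫⁻ ω, F ω ∂(M.pathMeasure π x)
      = ∫⁻ a, ∫⁻ ω, F ω ∂(M.pairMeasure π (x, a)) ∂(π.rule 0 (Fin.elim0, x)) := by
  unfold pathMeasure initialLaw
  rw [lintegral_trajMeasure _ _ hF]
  exact lintegral_map (M.measurable_lintegral_pairMeasure π hF) (by fun_prop)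

theorem stepKernel_shift (M : MDP X A) (π : M.Policy) (z : X × A) (n : ℕ)
    (w : (i : Finset.Iic n) → X × A) :
    M.stepKernel (π.shift z) n w = M.stepKernel π (n + 1) (consIic z w) := by
  have h1 := π.isMarkovKernel_rule (n + 2)
  have h2 := (π.shift z).isMarkovKernel_rule (n + 1)
  ext s hs
  unfold stepKernel
  rw [Kernel.compProd_apply hs, Kernel.compProd_apply hs]
  simp only [Kernel.comap_apply, Policy.shift]
  refine lintegral_congr fun y => ?_
  congr 3
  funext i
  refine Fin.cases rfl (fun j => rfl) i

theorem lintegral_shift_pairMeasure [MeasurableSingletonClass X] [MeasurableSingletonClass A]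
    (M : MDP X A) (π : M.Policy) (z : X × A)
    {F : (ℕ → X × A) → ℝ≥0∞} (hF : Measurable F) :
    ∫⁻ ω, F (fun n => ω (n + 1)) ∂(M.pairMeasure π z)
      = ∫⁻ y, ∫⁻ ω, F ω ∂(M.pathMeasure (π.shift z) y) ∂(M.transKernel z) := by
  have h1 := π.isMarkovKernel_rule 1
  rw [← lintegral_map (f := F) hF (by fun_prop), pairMeasure,
    map_shift_traj (M.stepKernel π) (M.stepKernel (π.shift z)) z (M.stepKernel_shift π z),
    lintegral_trajMeasure _ _ hF]
  have hG := M.measurable_lintegral_pairMeasure (π.shift z) hF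
  change ∫⁻ p, ∫⁻ ω, F ω ∂(M.pairMeasure (π.shift z) p) ∂_ = _
  unfold stepKernel
  rw [Kernel.lintegral_compProd _ _ _ hG]
  simp only [Kernel.comap_apply]
  refine lintegral_congr fun y => ?_
  rw [lintegral_pathMeasure _ _ _ hF]
  change _ = lintegral (π.rule 1 (Fin.cons z Fin.elim0, y)) _
  congr 3
  funext i
  obtain rfl : i = 0 := Fin.fin_one_eq_zero i
  rfl

theorem lintegral_zero_pairMeasure [MeasurableSingletonClass X] [MeasurableSingletonClass A]
    (M : MDP X A) (π : M.Policy) (z : X × A) (f : X × A → ℝ≥0∞) :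
    ∫⁻ ω, f (ω 0) ∂(M.pairMeasure π z) = f z := by
  have : IsProbabilityMeasure (M.pairMeasure π z) := by unfold pairMeasure; infer_instance
  have h : (fun ω => f (ω 0)) =ᵐ[M.pairMeasure π z] fun _ => f z :=
    (ae_traj_zero_eq (M.stepKernel π) z).mono fun ω hω => congrArg f hω
  rw [lintegral_congr_ae h]
  simp

theorem ae_rule_mem_actions {M : MDP X A} (π : M.Policy) (n : ℕ) (h : (Fin n → X × A) × X) :
    ∀ᵐ a ∂(π.rule n h), a ∈ M.actions h.2 := by
  have := π.isMarkovKernel_rule n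
  exact (mem_ae_iff_prob_eq_one (M.measurableSet_actions _)).2 (π.rule_actions n h)

/-- First-step decomposition of the expectation of `f(ω₀) + F(ω₁, ω₂, …)`. -/
theorem lintegral_pathMeasure_add_shift [MeasurableSingletonClass X] [MeasurableSingletonClass A]
    (M : MDP X A) (π : M.Policy) (x : X) {f : X × A → ℝ≥0∞} (hf : Measurable f)
    {F : (ℕ → X × A) → ℝ≥0∞} (hF : Measurable F) :
    ∫⁻ ω, (f (ω 0) + F fun n => ω (n + 1)) ∂(M.pathMeasure π x)
      = ∫⁻ a, (f (x, a) + ∫⁻ y, ∫⁻ ω, F ω ∂(M.pathMeasure (π.shift (x, a)) y)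
          ∂(M.trans (x, a))) ∂(π.rule 0 (Fin.elim0, x)) := by
  rw [lintegral_pathMeasure _ _ _ (by fun_prop)]
  refine lintegral_congr_ae ((ae_rule_mem_actions π 0 _).mono fun a ha => ?_)
  beta_reduce
  rw [lintegral_add_left (by fun_prop), lintegral_zero_pairMeasure,
    lintegral_shift_pairMeasure _ _ _ hF, transKernel_apply _ ha]

theorem ae_mem_graph [MeasurableSingletonClass X] [MeasurableSingletonClass A]
    (M : MDP X A) (π : M.Policy) (x : X) : ∀ᵐ ω ∂(M.pathMeasure π x), ∀ n, ω n ∈ M.graph := by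
  have hG : MeasurableSet M.graph := M.measurableSet_graph
  have hGc : Measurable (M.graphᶜ.indicator (1 : X × A → ℝ≥0∞)) :=
    measurable_one.indicator hG.compl
  -- The induction runs over all policies and states at once: conditioning on the first step turns
  -- time `n + 1` into time `n` under a shifted policy.
  have key : ∀ n (π : M.Policy) x,
      ∫⁻ ω, M.graphᶜ.indicator 1 (ω n) ∂(M.pathMeasure π x) = 0 := by
    intro n
    induction n with
    | zero =>
      intro π x
      have := M.lintegral_pathMeasure_add_shift π x hGc (F := 0) measurable_zero
      simp only [Pi.zero_apply, add_zero, lintegral_zero] at this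
      rw [this, lintegral_eq_zero_iff (by fun_prop)]
      filter_upwards [ae_rule_mem_actions π 0 (Fin.elim0, x)] with a ha
      have hxa : (x, a) ∉ M.graphᶜ := Set.notMem_compl_iff.2 ha
      exact Set.indicator_of_notMem hxa (1 : X × A → ℝ≥0∞)
    | succ n ih =>
      intro π x
      have := M.lintegral_pathMeasure_add_shift π x (f := 0) measurable_zero
        (F := fun ω => M.graphᶜ.indicator 1 (ω n)) (by fun_prop)
      simpa only [Pi.zero_apply, zero_add, ih, lintegral_zero] using this
  refine ae_all_iff.2 fun n => ?_
  have h := (lintegral_eq_zero_iff (by fun_prop)).1 (key n π x)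
  filter_upwards [h] with ω hω
  by_contra hn
  rw [Set.indicator_of_mem (show ω n ∈ M.graphᶜ from hn)] at hω
  exact one_ne_zero hω

end MDP

/-! ### Subtracting a finite constant from values in `[0, ∞]` -/

section LowerBy

/-- The extended real `e - d`, for `e ∈ [0, ∞]` and a nonnegative real `d`. -/
noncomputable def lowerBy (d : NNReal) (e : ℝ≥0∞) : EReal := (e : EReal) - ((d : ℝ) : EReal)

theorem lowerBy_top (d : NNReal) : lowerBy d ⊤ = ⊤ := rfl

theorem lowerBy_coe (d e : NNReal) : lowerBy d e = ((e - d : ℝ) : EReal) := rfl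

theorem lowerBy_zero_left (e : ℝ≥0∞) : lowerBy 0 e = e := by simp [lowerBy]

theorem lowerBy_add_coe (d : NNReal) (e : ℝ≥0∞) : lowerBy d e + ((d : ℝ) : EReal) = e :=
  EReal.sub_add_cancel

theorem lowerBy_le_lowerBy {d : NNReal} {e e' : ℝ≥0∞} : lowerBy d e ≤ lowerBy d e' ↔ e ≤ e' := by
  refine ⟨fun h => ?_, fun h => EReal.sub_le_sub (by exact_mod_cast h) le_rfl⟩
  have := add_le_add_left h ((d : ℝ) : EReal)
  rw [lowerBy_add_coe, lowerBy_add_coe] at this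
  exact_mod_cast this

theorem lowerBy_lt_lowerBy {d : NNReal} {e e' : ℝ≥0∞} : lowerBy d e < lowerBy d e' ↔ e < e' := by
  rw [← not_le, lowerBy_le_lowerBy, not_le]

theorem lowerBy_lt_top {d : NNReal} {e : ℝ≥0∞} : lowerBy d e < ⊤ ↔ e < ⊤ := by
  rw [← lowerBy_top d, lowerBy_lt_lowerBy]

theorem monotone_lowerBy (d : NNReal) : Monotone (lowerBy d) := fun _ _ h =>
  lowerBy_le_lowerBy.2 h

theorem continuous_lowerBy (d : NNReal) : Continuous (lowerBy d) := by
  refine continuous_iff_continuousAt.2 fun e => ?_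
  have h := EReal.continuousAt_add (p := ((e : EReal), -((d : ℝ) : EReal)))
    (Or.inr (by simp)) (Or.inr (by simp))
  exact ContinuousAt.comp (f := fun e : ℝ≥0∞ => ((e : EReal), -((d : ℝ) : EReal))) h
    (continuous_coe_ennreal_ereal.continuousAt.prodMk continuousAt_const)

/-- A monotone continuous map commutes with infima; that it fixes `∞` settles the empty index type.
-/
theorem lowerBy_iInf {ι : Sort*} (d : NNReal) (f : ι → ℝ≥0∞) :
    lowerBy d (⨅ i, f i) = ⨅ i, lowerBy d (f i) :=
  Monotone.map_iInf_of_continuousAt (continuous_lowerBy d).continuousAt (monotone_lowerBy d)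
    (lowerBy_top d)

theorem lowerBy_limsup {ι : Type*} (d : NNReal) (l : Filter ι) [l.NeBot] (f : ι → ℝ≥0∞) :
    lowerBy d (limsup f l) = limsup (fun i => lowerBy d (f i)) l :=
  Monotone.map_limsup_of_continuousAt (monotone_lowerBy d) f (continuous_lowerBy d).continuousAt

theorem lowerBy_liminf {ι : Type*} (d : NNReal) (l : Filter ι) [l.NeBot] (f : ι → ℝ≥0∞) :
    lowerBy d (liminf f l) = liminf (fun i => lowerBy d (f i)) l :=
  Monotone.map_liminf_of_continuousAt (monotone_lowerBy d) f (continuous_lowerBy d).continuousAt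

theorem lowerBy_add_lowerBy (d d' : NNReal) (e e' : ℝ≥0∞) :
    lowerBy d e + lowerBy d' e' = lowerBy (d + d') (e + e') := by
  induction e with
  | top =>
    rw [top_add, lowerBy_top, lowerBy_top]
    induction e' with
    | top => rfl
    | coe e' => rw [lowerBy_coe, EReal.top_add_coe]
  | coe e =>
    induction e' with
    | top => rw [add_top, lowerBy_top, lowerBy_top, lowerBy_coe, EReal.coe_add_top]
    | coe e' =>
      rw [← ENNReal.coe_add, lowerBy_coe, lowerBy_coe, lowerBy_coe, ← EReal.coe_add]
      exact congrArg _ (by push_cast; ring)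

theorem lowerBy_add_coe_ennreal (d : NNReal) (e e' : ℝ≥0∞) :
    lowerBy d e + (e' : EReal) = lowerBy d (e + e') := by
  rw [← lowerBy_zero_left e', lowerBy_add_lowerBy, add_zero]

theorem mul_lowerBy (c d : NNReal) (e : ℝ≥0∞) :
    ((c : ℝ) : EReal) * lowerBy d e = lowerBy (c * d) (c * e) := by
  induction e with
  | top =>
    rcases eq_or_ne c 0 with rfl | hc
    · simp [lowerBy]
    · rw [lowerBy_top, ENNReal.mul_top (by simpa using hc), lowerBy_top,
        EReal.coe_mul_top_of_pos (by simpa [pos_iff_ne_zero] using hc)]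
  | coe e =>
    rw [← ENNReal.coe_mul, lowerBy_coe, lowerBy_coe, ← EReal.coe_mul]
    exact congrArg _ (by push_cast; ring)

theorem lowerBy_sub_lowerBy (d m : NNReal) {e : ℝ≥0∞} (h : m ≤ e) :
    lowerBy d e - lowerBy d m = ((e - m : ℝ≥0∞) : EReal) := by
  induction e with
  | top => rfl
  | coe e =>
    have h' : m ≤ e := by exact_mod_cast h
    rw [lowerBy_coe, lowerBy_coe, ← ENNReal.coe_sub, EReal.coe_nnreal_eq_coe_real,
      NNReal.coe_sub h', ← EReal.coe_sub]
    exact congrArg _ (by ring)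

end LowerBy

/-! ### Passage to a nonnegative cost -/

namespace MDP

variable {X A : Type*} [MeasurableSpace X] [MeasurableSpace A]

/-- The cost raised by the constant `L`, as a function with values in `[0, ∞]` that vanishes
outside the graph. -/
noncomputable def raisedCost (M : MDP X A) (L : NNReal) : X × A → ℝ≥0∞ :=
  M.graph.indicator fun p => (M.cost p + ((L : ℝ) : EReal)).toENNReal

theorem measurable_raisedCost (M : MDP X A) (L : NNReal) : Measurable (M.raisedCost L) := by
  have hG : MeasurableSet M.graph := M.measurableSet_graph
  refine measurable_of_restrict_of_restrict_compl hG ?_ ?_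
  · have h : Measurable fun p : M.graph => (M.cost p + ((L : ℝ) : EReal)).toENNReal :=
      (M.measurable_cost.add_const _).ereal_toENNReal
    refine (congrArg Measurable (funext fun p => ?_)).mp h
    exact (Set.indicator_of_mem p.2
      fun p : X × A => (M.cost p + ((L : ℝ) : EReal)).toENNReal).symm
  · have h : Measurable fun p : ↥(M.graph)ᶜ => (0 : ℝ≥0∞) := measurable_const
    refine (congrArg Measurable (funext fun p => ?_)).mp h
    exact (Set.indicator_of_notMem p.2
      fun p : X × A => (M.cost p + ((L : ℝ) : EReal)).toENNReal).symm

theorem exists_neg_le_cost (M : MDP X A) :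
    ∃ L : NNReal, ∀ p ∈ M.graph, -((L : ℝ) : EReal) ≤ M.cost p := by
  obtain ⟨K, hK⟩ := M.cost_bddBelow
  refine ⟨(-K).toNNReal, fun p hp => le_trans ?_ (hK p hp)⟩
  rw [← EReal.coe_neg, EReal.coe_le_coe_iff, Real.coe_toNNReal']
  linarith [le_max_left (-K) 0]

theorem cost_eq_lowerBy {M : MDP X A} {L : NNReal}
    (hL : ∀ p ∈ M.graph, -((L : ℝ) : EReal) ≤ M.cost p) {p : X × A} (hp : p ∈ M.graph) :
    M.cost p = lowerBy L (M.raisedCost L p) := by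
  have h0 : 0 ≤ M.cost p + ((L : ℝ) : EReal) := by
    have := add_le_add_left (hL p hp) ((L : ℝ) : EReal)
    refine le_trans (le_of_eq ?_) this
    rw [← EReal.coe_neg, ← EReal.coe_add]
    simp
  rw [lowerBy, raisedCost, Set.indicator_of_mem hp, EReal.coe_toENNReal h0,
    EReal.add_sub_cancel_right]

variable [MeasurableSingletonClass X] [MeasurableSingletonClass A]

theorem horizonCost_eq_lowerBy {M : MDP X A} {L : NNReal}
    (hL : ∀ p ∈ M.graph, -((L : ℝ) : EReal) ≤ M.cost p) (π : M.Policy) (N : ℕ) (x : X) :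
    M.horizonCost π N x
      = lowerBy (N * L)
        (∫⁻ ω, ∑ n ∈ Finset.range N, M.raisedCost L (ω n) ∂(M.pathMeasure π x)) := by
  have hc := M.measurable_raisedCost L
  have hsum : ∀ ω : ℕ → X × A, (∀ n, ω n ∈ M.graph) → ∑ n ∈ Finset.range N, M.cost (ω n)
      = lowerBy (N * L) (∑ n ∈ Finset.range N, M.raisedCost L (ω n)) := fun ω hω => by
    induction N with
    | zero => simp [lowerBy]
    | succ N ih =>
      rw [Finset.sum_range_succ, Finset.sum_range_succ, ih, cost_eq_lowerBy hL (hω N),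
        lowerBy_add_lowerBy]
      congr 1
      push_cast
      ring
  rw [horizonCost, extIntegral_congr_ae ((M.ae_mem_graph π x).mono fun ω hω => hsum ω hω)]
  refine (extIntegral_coe_sub_coe _ (h := fun _ => ((N * L : NNReal) : ℝ≥0∞)) (by fun_prop)
    measurable_const (fun _ => ENNReal.coe_ne_top) (by simp [ENNReal.mul_eq_top])).trans ?_
  rw [lintegral_const, measure_univ, mul_one]
  rfl

theorem discCost_eq_lowerBy {M : MDP X A} {L : NNReal}
    (hL : ∀ p ∈ M.graph, -((L : ℝ) : EReal) ≤ M.cost p) (π : M.Policy) {a : NNReal}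
    (ha : a < 1) (x : X) :
    M.discCost π a x
      = lowerBy ((1 - a)⁻¹ * L)
        (∫⁻ ω, ∑' n, (a : ℝ≥0∞) ^ n * M.raisedCost L (ω n) ∂(M.pathMeasure π x)) := by
  have hc := M.measurable_raisedCost L
  -- The total discounted shift; it is finite, so the series may be split into the raised part and
  -- the shift.
  have hgeom : ∑' n : ℕ, (a : ℝ≥0∞) ^ n * (L : ℝ≥0∞) = (((1 - a)⁻¹ * L : NNReal) : ℝ≥0∞) := by
    rw [ENNReal.tsum_mul_right, ENNReal.tsum_geometric, ENNReal.coe_mul,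
      ENNReal.coe_inv (tsub_pos_of_lt ha).ne', ENNReal.coe_sub, ENNReal.coe_one]
  have hsum : ∀ ω : ℕ → X × A, (∀ n, ω n ∈ M.graph) →
      (extSum fun n => (((a : ℝ) ^ n : ℝ) : EReal) * M.cost (ω n))
      = lowerBy ((1 - a)⁻¹ * L) (∑' n, (a : ℝ≥0∞) ^ n * M.raisedCost L (ω n)) := fun ω hω => by
    have h1 : (fun n => (((a : ℝ) ^ n : ℝ) : EReal) * M.cost (ω n))
        = fun n => (((a : ℝ≥0∞) ^ n * M.raisedCost L (ω n) : ℝ≥0∞) : EReal)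
          - (((a ^ n * L : NNReal) : ℝ≥0∞) : EReal) := funext fun n => by
      rw [cost_eq_lowerBy hL (hω n), ← NNReal.coe_pow, mul_lowerBy, ENNReal.coe_pow]
      rfl
    rw [h1, extSum_eq_extIntegral_count, extIntegral_coe_sub_coe _ (measurable_of_countable _)
      (measurable_of_countable _) (fun _ => ENNReal.coe_ne_top)]
    · simp_rw [lintegral_count, ENNReal.coe_mul, ENNReal.coe_pow, hgeom]
      rfl
    · simp_rw [lintegral_count, ENNReal.coe_mul, ENNReal.coe_pow, hgeom]
      exact ENNReal.coe_ne_top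
  rw [discCost, extIntegral_congr_ae ((M.ae_mem_graph π x).mono fun ω hω => hsum ω hω)]
  refine (extIntegral_coe_sub_coe _ (h := fun _ => (((1 - a)⁻¹ * L : NNReal) : ℝ≥0∞))
    (by fun_prop) measurable_const (fun _ => ENNReal.coe_ne_top)
    (by simp only [lintegral_const, measure_univ, mul_one]; exact ENNReal.coe_ne_top)).trans ?_
  rw [lintegral_const, measure_univ, mul_one]
  rfl

end MDP

/-! ### Values for the raised cost and limits as `α ↑ 1` -/

theorem eventually_toNNReal_lt_one :
    ∀ᶠ α : ℝ in 𝓝[<] 1, α.toNNReal < 1 ∧ (α.toNNReal : ℝ) = α := by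
  have h : Set.Ioo (0 : ℝ) 1 ∈ 𝓝[<] (1 : ℝ) := Ioo_mem_nhdsLT one_pos
  filter_upwards [h] with α hα
  exact ⟨Real.toNNReal_lt_one.2 hα.2, Real.coe_toNNReal _ hα.1.le⟩

theorem tendsto_toNNReal_nhdsLT_one :
    Tendsto (fun α : ℝ => (α.toNNReal : ℝ≥0∞)) (𝓝[<] 1) (𝓝 1) := by
  have h : Continuous fun α : ℝ => (α.toNNReal : ℝ≥0∞) :=
    ENNReal.continuous_coe.comp continuous_real_toNNReal
  simpa using (h.tendsto 1).mono_left nhdsWithin_le_nhds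

namespace MDP

variable {X A : Type*} [MeasurableSpace X] [MeasurableSpace A]

/-- The expected total cost over the horizon `N` for the raised cost. -/
noncomputable def raisedHorizon (M : MDP X A) (L : NNReal) (π : M.Policy) (N : ℕ) (x : X) :
    ℝ≥0∞ :=
  ∫⁻ ω, ∑ n ∈ Finset.range N, M.raisedCost L (ω n) ∂(M.pathMeasure π x)

/-- The expected discounted cost for the raised cost. -/
noncomputable def raisedDisc (M : MDP X A) (L : NNReal) (π : M.Policy) (a : NNReal) (x : X) :
    ℝ≥0∞ :=
  ∫⁻ ω, ∑' n, (a : ℝ≥0∞) ^ n * M.raisedCost L (ω n) ∂(M.pathMeasure π x)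

/-- The average cost for the raised cost. -/
noncomputable def raisedAvg (M : MDP X A) (L : NNReal) (π : M.Policy) (x : X) : ℝ≥0∞ :=
  limsup (fun N : ℕ => (N : ℝ≥0∞)⁻¹ * M.raisedHorizon L π N x) atTop

/-- The optimal discounted cost for the raised cost. -/
noncomputable def raisedValue (M : MDP X A) (L : NNReal) (a : NNReal) (x : X) : ℝ≥0∞ :=
  ⨅ π : M.Policy, M.raisedDisc L π a x

/-- The minimal optimal discounted cost for the raised cost. -/
noncomputable def raisedMin (M : MDP X A) (L : NNReal) (a : NNReal) : ℝ≥0∞ :=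
  ⨅ x, M.raisedValue L a x

/-- The relative discounted value for the raised cost. -/
noncomputable def raisedRel (M : MDP X A) (L : NNReal) (a : NNReal) (x : X) : ℝ≥0∞ :=
  M.raisedValue L a x - M.raisedMin L a

/-- The upper limit of the normalized minimal discounted costs, for the raised cost. -/
noncomputable def raisedBar (M : MDP X A) (L : NNReal) : ℝ≥0∞ :=
  limsup (fun α : ℝ => (1 - (α.toNNReal : ℝ≥0∞)) * M.raisedMin L α.toNNReal) (𝓝[<] 1)

theorem raisedMin_le_raisedValue (M : MDP X A) (L a : NNReal) (x : X) :
    M.raisedMin L a ≤ M.raisedValue L a x := iInf_le _ x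

theorem raisedRel_add_raisedMin (M : MDP X A) (L a : NNReal) (x : X) :
    M.raisedRel L a x + M.raisedMin L a = M.raisedValue L a x :=
  tsub_add_cancel_of_le (M.raisedMin_le_raisedValue L a x)

theorem one_sub_mul_lowerBy {L a : NNReal} (ha : a < 1) (e : ℝ≥0∞) :
    ((1 - a : ℝ) : EReal) * lowerBy ((1 - a)⁻¹ * L) e = lowerBy L ((1 - (a : ℝ≥0∞)) * e) := by
  have h : (1 - a : ℝ) = ((1 - a : NNReal) : ℝ) := by
    rw [NNReal.coe_sub ha.le, NNReal.coe_one]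
  rw [h, mul_lowerBy, ← mul_assoc, mul_inv_cancel₀ (tsub_pos_of_lt ha).ne', one_mul,
    ENNReal.coe_sub, ENNReal.coe_one]

theorem oneStep_eq_lowerBy {M : MDP X A} {L : NNReal}
    (hL : ∀ p ∈ M.graph, -((L : ℝ) : EReal) ≤ M.cost p) (g : X → ℝ≥0∞) {x : X} {b : A}
    (hb : b ∈ M.actions x) :
    M.oneStep (fun y => (g y : EReal)) x b
      = lowerBy L (M.raisedCost L (x, b) + ∫⁻ y, g y ∂(M.trans (x, b))) := by
  rw [oneStep, cost_eq_lowerBy hL hb, extIntegral_of_nonneg _ fun y => EReal.coe_ennreal_nonneg _,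
    lowerBy_add_coe_ennreal]
  simp

section Reduction

variable [MeasurableSingletonClass X] [MeasurableSingletonClass A]

variable {M : MDP X A} {L : NNReal}

theorem discValue_eq_lowerBy (hL : ∀ p ∈ M.graph, -((L : ℝ) : EReal) ≤ M.cost p)
    {a : NNReal} (ha : a < 1) (x : X) :
    M.discValue a x = lowerBy ((1 - a)⁻¹ * L) (M.raisedValue L a x) := by
  rw [discValue, raisedValue, lowerBy_iInf]
  exact iInf_congr fun π => discCost_eq_lowerBy hL π ha x

theorem minDisc_eq_lowerBy (hL : ∀ p ∈ M.graph, -((L : ℝ) : EReal) ≤ M.cost p)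
    {a : NNReal} (ha : a < 1) :
    M.minDisc a = lowerBy ((1 - a)⁻¹ * L) (M.raisedMin L a) := by
  rw [minDisc, raisedMin, lowerBy_iInf]
  exact iInf_congr fun x => discValue_eq_lowerBy hL ha x

theorem wBar_eq_lowerBy (hL : ∀ p ∈ M.graph, -((L : ℝ) : EReal) ≤ M.cost p) :
    M.wBar = lowerBy L (M.raisedBar L) := by
  rw [wBar, raisedBar, lowerBy_limsup]
  refine limsup_congr (eventually_toNNReal_lt_one.mono fun α ⟨h1, h2⟩ => ?_)
  rw [← one_sub_mul_lowerBy h1, ← minDisc_eq_lowerBy hL h1, h2]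

theorem limsup_discValue_eq_lowerBy (hL : ∀ p ∈ M.graph, -((L : ℝ) : EReal) ≤ M.cost p) (x : X) :
    limsup (fun α : ℝ => ((1 - α : ℝ) : EReal) * M.discValue α x) (𝓝[<] 1)
      = lowerBy L (limsup (fun α : ℝ => (1 - (α.toNNReal : ℝ≥0∞)) * M.raisedValue L α.toNNReal x)
        (𝓝[<] 1)) := by
  rw [lowerBy_limsup]
  refine limsup_congr (eventually_toNNReal_lt_one.mono fun α ⟨h1, h2⟩ => ?_)
  rw [← one_sub_mul_lowerBy h1, ← discValue_eq_lowerBy hL h1, h2]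

theorem avgCost_eq_lowerBy (hL : ∀ p ∈ M.graph, -((L : ℝ) : EReal) ≤ M.cost p) (π : M.Policy)
    (x : X) : M.avgCost π x = lowerBy L (M.raisedAvg L π x) := by
  rw [avgCost, raisedAvg, lowerBy_limsup]
  refine limsup_congr ((eventually_ge_atTop 1).mono fun N hN => ?_)
  have hN' : (N : NNReal) ≠ 0 := by simpa using (by omega : N ≠ 0)
  have h : ((N : ℝ)⁻¹ : ℝ) = ((N : NNReal)⁻¹ : NNReal) := by simp
  rw [horizonCost_eq_lowerBy hL, h, mul_lowerBy, ← mul_assoc, inv_mul_cancel₀ hN', one_mul,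
    ENNReal.coe_inv hN', ENNReal.coe_natCast]
  rfl

theorem avgValue_eq_lowerBy (hL : ∀ p ∈ M.graph, -((L : ℝ) : EReal) ≤ M.cost p) (x : X) :
    M.avgValue x = lowerBy L (⨅ π : M.Policy, M.raisedAvg L π x) := by
  rw [avgValue, lowerBy_iInf]
  exact iInf_congr fun π => avgCost_eq_lowerBy hL π x

theorem wStar_eq_lowerBy (hL : ∀ p ∈ M.graph, -((L : ℝ) : EReal) ≤ M.cost p) :
    M.wStar = lowerBy L (⨅ x, ⨅ π : M.Policy, M.raisedAvg L π x) := by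
  rw [wStar, lowerBy_iInf]
  exact iInf_congr fun x => avgValue_eq_lowerBy hL x

/-- The two shifts cancel in the difference. Finiteness of the minimum matters: `∞ - ∞` is 0 in
`ℝ≥0∞` but `⊥` in `EReal`. -/
theorem relDisc_eq_coe (hL : ∀ p ∈ M.graph, -((L : ℝ) : EReal) ≤ M.cost p)
    {a : NNReal} (ha : a < 1) (hm : M.raisedMin L a ≠ ⊤) (x : X) :
    M.relDisc a x = (M.raisedRel L a x : EReal) := by
  have h := M.raisedMin_le_raisedValue L a x
  rw [relDisc, discValue_eq_lowerBy hL ha, minDisc_eq_lowerBy hL ha, raisedRel]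
  lift M.raisedMin L a to NNReal using hm with m
  exact lowerBy_sub_lowerBy _ m h

end Reduction

/-! ### Discounted and average values: bounds and the optimality inequality -/

section Discounting

variable (M : MDP X A) (L : NNReal)

/-- The constant `C` is uniform in the discount factor. Hence the bound serves both the limit `α ↑
1` and the finiteness of `m_α` for each `α`. -/
theorem exists_one_sub_mul_raisedDisc_le (π : M.Policy) (x : X) {b : ℝ≥0∞}
    (h : M.raisedAvg L π x < b) (hb : b ≠ ⊤) :
    ∃ C : ℝ≥0∞, C ≠ ⊤ ∧ ∀ a : NNReal, a < 1 →
      (1 - (a : ℝ≥0∞)) * M.raisedDisc L π a x ≤ (1 - (a : ℝ≥0∞)) * C + b := by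
  have hc := M.measurable_raisedCost L
  have hH : ∀ N, M.raisedHorizon L π N x
      = ∑ n ∈ Finset.range N, ∫⁻ ω, M.raisedCost L (ω n) ∂(M.pathMeasure π x) := fun N =>
    lintegral_finsetSum _ fun n _ => by fun_prop
  have hD : ∀ a : NNReal, M.raisedDisc L π a x
      = ∑' n, (a : ℝ≥0∞) ^ n * ∫⁻ ω, M.raisedCost L (ω n) ∂(M.pathMeasure π x) := fun a => by
    rw [raisedDisc, lintegral_tsum fun n => Measurable.aemeasurable (by fun_prop)]
    exact tsum_congr fun n => lintegral_const_mul _ (by fun_prop)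
  simp_rw [raisedAvg, hH] at h
  obtain ⟨C, hC, hle⟩ := ENNReal.exists_sum_range_le_of_limsup_lt _ h hb
  refine ⟨C, hC, fun a ha => ?_⟩
  rw [hD]
  exact ENNReal.one_sub_mul_tsum_le _ (by exact_mod_cast ha) _ _ _ hle

theorem limsup_raisedDisc_le_raisedAvg (π : M.Policy) (x : X) :
    limsup (fun α : ℝ => (1 - (α.toNNReal : ℝ≥0∞)) * M.raisedDisc L π α.toNNReal x) (𝓝[<] 1)
      ≤ M.raisedAvg L π x := by
  refine le_of_forall_gt_imp_ge_of_dense fun b hb => ?_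
  rcases eq_or_ne b ⊤ with rfl | hb'
  · exact le_top
  obtain ⟨C, hC, hle⟩ := M.exists_one_sub_mul_raisedDisc_le L π x hb hb'
  have hlim : Tendsto (fun α : ℝ => (1 - (α.toNNReal : ℝ≥0∞)) * C + b) (𝓝[<] 1) (𝓝 b) := by
    have h1 : Tendsto (fun α : ℝ => 1 - (α.toNNReal : ℝ≥0∞)) (𝓝[<] 1) (𝓝 (1 - 1)) :=
      ENNReal.Tendsto.sub tendsto_const_nhds tendsto_toNNReal_nhdsLT_one (by simp)
    rw [tsub_self] at h1
    simpa using (ENNReal.Tendsto.mul_const h1 (Or.inr hC)).add_const b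
  rw [← hlim.limsup_eq]
  exact limsup_le_limsup (eventually_toNNReal_lt_one.mono fun α hα => hle _ hα.1)

theorem raisedMin_ne_top (h : (⨅ x, ⨅ π : M.Policy, M.raisedAvg L π x) < ⊤) {a : NNReal}
    (ha : a < 1) : M.raisedMin L a ≠ ⊤ := by
  obtain ⟨x, hx⟩ := iInf_lt_iff.1 h
  obtain ⟨π, hπ⟩ := iInf_lt_iff.1 hx
  obtain ⟨b, hb, hb'⟩ := exists_between hπ
  obtain ⟨C, hC, hle⟩ := M.exists_one_sub_mul_raisedDisc_le L π x hb hb'.ne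
  refine ne_top_of_le_ne_top (b := M.raisedDisc L π a x) (fun htop => ?_)
    ((M.raisedMin_le_raisedValue L a x).trans (iInf_le _ π))
  have h1 := hle a ha
  have ha' : (1 : ℝ≥0∞) - a ≠ 0 := (tsub_pos_of_lt (by exact_mod_cast ha)).ne'
  rw [htop, ENNReal.mul_top ha', top_le_iff] at h1
  exact ENNReal.add_ne_top.2 ⟨ENNReal.mul_ne_top (ENNReal.sub_ne_top ENNReal.one_ne_top) hC,
    hb'.ne⟩ h1

theorem raisedBar_le_raisedAvg (π : M.Policy) (x : X) : M.raisedBar L ≤ M.raisedAvg L π x :=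
  (limsup_le_limsup (Eventually.of_forall fun α => by
    gcongr; exact (M.raisedMin_le_raisedValue L _ x).trans (iInf_le _ π))).trans
    (M.limsup_raisedDisc_le_raisedAvg L π x)

variable [MeasurableSingletonClass X] [MeasurableSingletonClass A]

theorem raisedDisc_eq_lintegral (π : M.Policy) (a : NNReal) (x : X) :
    M.raisedDisc L π a x = ∫⁻ b, (M.raisedCost L (x, b)
      + a * ∫⁻ y, M.raisedDisc L (π.shift (x, b)) a y ∂(M.trans (x, b)))
        ∂(π.rule 0 (Fin.elim0, x)) := by
  have hc := M.measurable_raisedCost L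
  have hF : Measurable fun ω : ℕ → X × A => ∑' n, (a : ℝ≥0∞) ^ n * M.raisedCost L (ω n) := by
    fun_prop
  have h := M.lintegral_pathMeasure_add_shift π x hc (hF.const_mul (a : ℝ≥0∞))
  simp_rw [lintegral_const_mul _ hF, lintegral_const_mul' _ _ ENNReal.coe_ne_top] at h
  refine Eq.trans (lintegral_congr fun ω => ?_) h
  rw [tsum_eq_zero_add' ENNReal.summable, pow_zero, one_mul, ← ENNReal.tsum_mul_left]
  simp_rw [pow_succ', mul_assoc]

/-- One inequality of the optimality equation for discounted costs, up to `ε`. The integral on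
the left is a lower integral. -/
theorem exists_raisedCost_add_le {a : NNReal} (ha : a < 1) (hm : M.raisedMin L a ≠ ⊤) (x : X)
    {ε : ℝ≥0∞} (hε : ε ≠ 0) :
    ∃ b ∈ M.actions x, M.raisedCost L (x, b) + a * ∫⁻ y, M.raisedRel L a y ∂(M.trans (x, b))
      ≤ M.raisedRel L a x + (1 - (a : ℝ≥0∞)) * M.raisedMin L a + ε := by
  obtain ⟨φ, -, hφ⟩ := M.exists_selector
  rcases eq_or_ne (M.raisedValue L a x) ⊤ with hV | hV
  · refine ⟨φ x, hφ x, ?_⟩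
    rw [raisedRel, hV, ENNReal.top_sub hm]
    simp
  obtain ⟨π, hπ⟩ := iInf_lt_iff.1 (show (⨅ π : M.Policy, M.raisedDisc L π a x)
    < M.raisedValue L a x + ε from ENNReal.lt_add_right hV hε)
  rw [raisedDisc_eq_lintegral] at hπ
  have := π.isMarkovKernel_rule 0
  -- A function whose mean under the first decision rule is below `v_α(x) + ε` cannot exceed that
  -- bound at every available action.
  obtain ⟨b, hb, hlt⟩ : ∃ b ∈ M.actions x, M.raisedCost L (x, b)
      + a * ∫⁻ y, M.raisedDisc L (π.shift (x, b)) a y ∂(M.trans (x, b))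
        ≤ M.raisedValue L a x + ε := by
    by_contra! hcon
    refine hπ.not_ge ?_
    calc M.raisedValue L a x + ε
        = ∫⁻ _, (M.raisedValue L a x + ε) ∂(π.rule 0 (Fin.elim0, x)) := by simp
      _ ≤ _ := lintegral_mono_ae ((ae_rule_mem_actions π 0 (Fin.elim0, x)).mono
          fun b hb => (hcon b hb).le)
  refine ⟨b, hb, ?_⟩
  have := M.isProbabilityMeasure_trans (x, b)
  -- Adding the finite term `α m_α` to both sides turns `u_α` into `v_α`, which bounds the
  -- continuation cost of any policy from below.
  have ham : (a : ℝ≥0∞) * M.raisedMin L a ≠ ⊤ := ENNReal.mul_ne_top ENNReal.coe_ne_top hm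
  refine (ENNReal.add_le_add_iff_right ham).1 ?_
  calc M.raisedCost L (x, b) + a * ∫⁻ y, M.raisedRel L a y ∂(M.trans (x, b))
        + a * M.raisedMin L a
      = M.raisedCost L (x, b)
        + a * ∫⁻ y, (M.raisedRel L a y + M.raisedMin L a) ∂(M.trans (x, b)) := by
        rw [lintegral_add_right _ measurable_const, lintegral_const, measure_univ, mul_one,
          mul_add, add_assoc]
    _ ≤ M.raisedCost L (x, b)
        + a * ∫⁻ y, M.raisedDisc L (π.shift (x, b)) a y ∂(M.trans (x, b)) := by
        gcongr with y
        rw [raisedRel_add_raisedMin]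
        exact iInf_le _ _
    _ ≤ M.raisedValue L a x + ε := hlt
    _ = M.raisedRel L a x + (1 - (a : ℝ≥0∞)) * M.raisedMin L a + ε + a * M.raisedMin L a := by
        have h1 : (1 - (a : ℝ≥0∞)) * M.raisedMin L a + a * M.raisedMin L a = M.raisedMin L a := by
          rw [← add_mul, tsub_add_cancel_of_le (by exact_mod_cast ha.le), one_mul]
        have h2 : M.raisedRel L a x + ((1 - (a : ℝ≥0∞)) * M.raisedMin L a + a * M.raisedMin L a)
            = M.raisedValue L a x := by rw [h1, raisedRel_add_raisedMin]
        rw [← h2]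
        ring

theorem raisedHorizon_succ (φ : M.StationaryPolicy) (N : ℕ) (x : X) :
    M.raisedHorizon L φ.toPolicy (N + 1) x = M.raisedCost L (x, φ.toFun x)
      + ∫⁻ y, M.raisedHorizon L φ.toPolicy N y ∂(M.trans (x, φ.toFun x)) := by
  have hc := M.measurable_raisedCost L
  have h := M.lintegral_pathMeasure_add_shift φ.toPolicy x hc
    (F := fun ω => ∑ n ∈ Finset.range N, M.raisedCost L (ω n)) (by fun_prop)
  simp_rw [φ.shift_toPolicy] at h
  have hrule : φ.toPolicy.rule 0 (Fin.elim0, x) = Measure.dirac (φ.toFun x) :=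
    Kernel.deterministic_apply (φ.measurable.comp measurable_snd) _
  rw [hrule, lintegral_dirac] at h
  refine Eq.trans (lintegral_congr fun ω => ?_) h
  rw [Finset.sum_range_succ', add_comm]

/-- Iteration of the optimality inequality, with `u ≥ 0` as terminal cost. -/
theorem raisedHorizon_le (φ : M.StationaryPolicy) {u : X → ℝ≥0∞} {w : ℝ≥0∞}
    (h : ∀ x, M.raisedCost L (x, φ.toFun x) + ∫⁻ y, u y ∂(M.trans (x, φ.toFun x)) ≤ w + u x)
    (N : ℕ) (x : X) : M.raisedHorizon L φ.toPolicy N x ≤ N * w + u x := by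
  induction N generalizing x with
  | zero => simp [raisedHorizon]
  | succ N ih =>
    have := M.isProbabilityMeasure_trans (x, φ.toFun x)
    calc M.raisedHorizon L φ.toPolicy (N + 1) x
        ≤ M.raisedCost L (x, φ.toFun x)
          + ∫⁻ y, (N * w + u y) ∂(M.trans (x, φ.toFun x)) := by
          rw [raisedHorizon_succ]
          gcongr with y
          exact ih y
      _ = N * w + (M.raisedCost L (x, φ.toFun x) + ∫⁻ y, u y ∂(M.trans (x, φ.toFun x))) := by
          rw [lintegral_add_left measurable_const, lintegral_const, measure_univ, mul_one]
          ring
      _ ≤ N * w + (w + u x) := add_le_add_right (h x) _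
      _ = (N + 1 : ℕ) * w + u x := by push_cast; ring

theorem raisedAvg_le (φ : M.StationaryPolicy) {u : X → ℝ≥0∞} {w : ℝ≥0∞}
    (h : ∀ x, M.raisedCost L (x, φ.toFun x) + ∫⁻ y, u y ∂(M.trans (x, φ.toFun x)) ≤ w + u x)
    (x : X) (hx : u x ≠ ⊤) : M.raisedAvg L φ.toPolicy x ≤ w := by
  have hlim : Tendsto (fun N : ℕ => w + (N : ℝ≥0∞)⁻¹ * u x) atTop (𝓝 w) := by
    simpa using (ENNReal.Tendsto.mul_const ENNReal.tendsto_inv_nat_nhds_zero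
      (Or.inr hx)).const_add w
  rw [← hlim.limsup_eq]
  refine limsup_le_limsup ((eventually_ge_atTop 1).mono fun N hN => ?_)
  have hN' : (N : ℝ≥0∞) ≠ 0 := by simpa using (by omega : N ≠ 0)
  calc (N : ℝ≥0∞)⁻¹ * M.raisedHorizon L φ.toPolicy N x
      ≤ (N : ℝ≥0∞)⁻¹ * (N * w + u x) := by gcongr; exact M.raisedHorizon_le L φ h N x
    _ = w + (N : ℝ≥0∞)⁻¹ * u x := by
      rw [mul_add, ← mul_assoc, ENNReal.inv_mul_cancel hN' (ENNReal.natCast_ne_top N), one_mul]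

end Discounting

/-- The common value of the optimal average costs and of the limits of the normalized discounted
costs under a stationary policy that satisfies the optimality inequality. -/
theorem isAvgOptimal_of_raisedCost_add_le [MeasurableSingletonClass X]
    [MeasurableSingletonClass A] {M : MDP X A} {L : NNReal}
    (hL : ∀ p ∈ M.graph, -((L : ℝ) : EReal) ≤ M.cost p) (φ : M.StationaryPolicy)
    {u : X → ℝ≥0∞} (hu : ∀ x, u x ≠ ⊤)
    (h : ∀ x, M.raisedCost L (x, φ.toFun x) + ∫⁻ y, u y ∂(M.trans (x, φ.toFun x))
      ≤ M.raisedBar L + u x) :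
    M.IsAvgOptimal φ.toPolicy ∧
      ∀ x, M.avgValue x = M.avgCost φ.toPolicy x ∧
        M.avgCost φ.toPolicy x
          = limsup (fun α : ℝ => ((1 - α : ℝ) : EReal) * M.discValue α x) (𝓝[<] 1) ∧
        limsup (fun α : ℝ => ((1 - α : ℝ) : EReal) * M.discValue α x) (𝓝[<] 1) = M.wBar ∧
        M.wBar = M.wStar := by
  have h1 : ∀ x, M.raisedAvg L φ.toPolicy x = M.raisedBar L := fun x =>
    le_antisymm (M.raisedAvg_le L φ h x (hu x)) (M.raisedBar_le_raisedAvg L _ x)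
  have h2 : ∀ x, ⨅ π : M.Policy, M.raisedAvg L π x = M.raisedBar L := fun x =>
    le_antisymm ((iInf_le _ φ.toPolicy).trans (h1 x).le)
      (le_iInf fun π => M.raisedBar_le_raisedAvg L π x)
  -- A state is needed here, since the infimum over an empty state space would be `∞`.
  have h3 : ∀ x : X, ⨅ x, ⨅ π : M.Policy, M.raisedAvg L π x = M.raisedBar L := fun x =>
    le_antisymm ((iInf_le _ x).trans (h2 x).le) (le_iInf fun x => (h2 x).ge)
  have h4 : ∀ x, limsup (fun α : ℝ => (1 - (α.toNNReal : ℝ≥0∞)) * M.raisedValue L α.toNNReal x)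
      (𝓝[<] 1) = M.raisedBar L := fun x => by
    refine le_antisymm ?_ (limsup_le_limsup (Eventually.of_forall fun α =>
      mul_le_mul' le_rfl (M.raisedMin_le_raisedValue L _ x)))
    refine le_trans ?_ ((M.limsup_raisedDisc_le_raisedAvg L φ.toPolicy x).trans (h1 x).le)
    exact limsup_le_limsup (Eventually.of_forall fun α =>
      mul_le_mul' le_rfl (iInf_le _ φ.toPolicy))
  have key : ∀ x, M.avgCost φ.toPolicy x = M.avgValue x := fun x => by
    rw [avgCost_eq_lowerBy hL, avgValue_eq_lowerBy hL, h1, h2]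
  refine ⟨key, fun x => ⟨(key x).symm, ?_, ?_, ?_⟩⟩
  · rw [avgCost_eq_lowerBy hL, limsup_discValue_eq_lowerBy hL, h1, h4]
  · rw [limsup_discValue_eq_lowerBy hL, wBar_eq_lowerBy hL, h4]
  · rw [wBar_eq_lowerBy hL, wStar_eq_lowerBy hL, h3 x]

end MDP

/-! ### Limit of the discounted optimality inequalities -/

namespace MDP

variable {X A : Type*} [MeasurableSpace X] [MeasurableSpace A] [TopologicalSpace X]

/-- The lower limit of the relative discounted values, for the raised cost. -/
noncomputable def raisedLimit (M : MDP X A) (L : NNReal) (x : X) : ℝ≥0∞ :=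
  liminf (fun p : ℝ × X => M.raisedRel L p.1.toNNReal p.2) (𝓝[<] (1 : ℝ) ×ˢ 𝓝 x)

theorem lowerSemicontinuous_raisedLimit (M : MDP X A) (L : NNReal) :
    LowerSemicontinuous (M.raisedLimit L) :=
  lowerSemicontinuous_liminf_prod_nhds _ _

theorem relLimit_eq_coe [MeasurableSingletonClass X] [MeasurableSingletonClass A]
    {M : MDP X A} {L : NNReal} (hL : ∀ p ∈ M.graph, -((L : ℝ) : EReal) ≤ M.cost p)
    (hm : ∀ a : NNReal, a < 1 → M.raisedMin L a ≠ ⊤) :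
    M.relLimit = fun x => (M.raisedLimit L x : EReal) := by
  funext x
  rw [relLimit, raisedLimit, ← lowerBy_zero_left, lowerBy_liminf]
  refine liminf_congr ((eventually_toNNReal_lt_one.prod_inl _).mono fun p ⟨h1, h2⟩ => ?_)
  rw [lowerBy_zero_left, ← relDisc_eq_coe hL h1 (hm _ h1), h2]

theorem relLimit_le_liminf_relDisc (M : MDP X A) (x : X) :
    M.relLimit x ≤ liminf (fun α : ℝ => M.relDisc α x) (𝓝[<] 1) := by
  have h : Tendsto (fun α : ℝ => (α, x)) (𝓝[<] 1) (𝓝[<] (1 : ℝ) ×ˢ 𝓝 x) :=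
    tendsto_id.prodMk tendsto_const_nhds
  exact liminf_le_liminf_of_le (u := fun p : ℝ × X => M.relDisc p.1 p.2) h

section Limits

variable [TopologicalSpace A] [TopologicalSpace.MetrizableSpace X] [BorelSpace X]
  [TopologicalSpace.MetrizableSpace A]
  {M : MDP X A} {L : NNReal}

/-- Passage to the limit in the one-step operator along state-action pairs and integrands. -/
theorem AssumptionWStar.exists_mapClusterPt (hW : M.AssumptionWStar)
    (hL : ∀ p ∈ M.graph, -((L : ℝ) : EReal) ≤ M.cost p)
    {x : ℕ → X} {x₀ : X} (hx : Tendsto x atTop (𝓝 x₀)) {b : ℕ → A}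
    (hb : ∀ n, b n ∈ M.actions (x n)) {f : ℕ → X → ℝ≥0∞} {g : X → ℝ≥0∞}
    (hg : ∀ y, g y ≤ liminf (fun p : ℕ × X => f p.1 p.2) (atTop ×ˢ 𝓝 y)) {C : ℝ≥0∞} (hC : C ≠ ⊤)
    (hle : ∀ n, M.raisedCost L (x n, b n) + ∫⁻ y, f n y ∂(M.trans (x n, b n)) ≤ C) :
    ∃ b₀ ∈ M.actions x₀, MapClusterPt b₀ atTop b ∧
      M.raisedCost L (x₀, b₀) + ∫⁻ y, g y ∂(M.trans (x₀, b₀)) ≤ C := by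
  let := TopologicalSpace.metrizableSpaceMetric X
  lift C to NNReal using hC
  obtain ⟨b₀, hb₀, hcl⟩ := hW.limit_point x x₀ hx b hb ⟨C - L, fun n => by
    rw [cost_eq_lowerBy hL (hb n), ← lowerBy_coe, lowerBy_le_lowerBy]
    exact le_self_add.trans (hle n)⟩
  refine ⟨b₀, hb₀, hcl, ?_⟩
  obtain ⟨ψ, hψ, hlim⟩ := hcl.tendsto_subseq
  have hψ' := hψ.tendsto_atTop
  have hp : Tendsto (fun n => (x (ψ n), b (ψ n))) atTop (𝓝[M.graph] (x₀, b₀)) :=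
    tendsto_nhdsWithin_iff.2 ⟨(hx.comp hψ').prodMk_nhds hlim, Eventually.of_forall fun n => hb _⟩
  have hcost : M.raisedCost L (x₀, b₀)
      ≤ liminf (fun n => M.raisedCost L (x (ψ n), b (ψ n))) atTop := by
    refine le_of_forall_lt_imp_le_of_dense fun e he => ?_
    refine le_liminf_of_le (by isBoundedDefault) ?_
    have h1 : lowerBy L e < M.cost (x₀, b₀) := by
      rwa [cost_eq_lowerBy hL hb₀, lowerBy_lt_lowerBy]
    filter_upwards [hp.eventually (hW.lsc_cost (x₀, b₀) hb₀ _ h1)] with n hn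
    rw [cost_eq_lowerBy hL (hb _), gt_iff_lt, lowerBy_lt_lowerBy] at hn
    exact hn.le
  have hprob := M.isProbabilityMeasure_trans
  have hint : ∫⁻ y, g y ∂(M.trans (x₀, b₀))
      ≤ liminf (fun n => ∫⁻ y, f (ψ n) y ∂(M.trans (x (ψ n), b (ψ n)))) atTop := by
    -- The hypothesis on the joint lower limit of `f` passes to the subsequence, so Fatou's lemma
    -- applies along the weakly converging transition probabilities.
    refine lintegral_le_liminf_of_tendsto_integral (fun h => (hW.weak h _ hb₀).tendsto.comp hp)
      fun y => (hg y).trans ?_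
    exact liminf_le_liminf_of_le (u := fun p : ℕ × X => f p.1 p.2)
      (g := map (Prod.map ψ id) (atTop ×ˢ 𝓝 y)) (hψ'.prodMap tendsto_id)
  refine (add_le_add hcost hint).trans ((ENNReal.add_liminf_le _ _).trans ?_)
  exact (liminf_le_liminf (Eventually.of_forall fun n => hle (ψ n))).trans (by simp)

theorem AssumptionWStar.seqInfCompact (hW : M.AssumptionWStar)
    (hL : ∀ p ∈ M.graph, -((L : ℝ) : EReal) ≤ M.cost p) {u : X → ℝ≥0∞}
    (hu : LowerSemicontinuous u) :
    SeqInfCompact M.actions fun x b => M.raisedCost L (x, b) + ∫⁻ y, u y ∂(M.trans (x, b)) := by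
  intro x x₀ b C hC hx hb hle
  refine hW.exists_mapClusterPt hL hx hb (f := fun _ => u) (fun y => ?_) hC hle
  refine le_of_forall_lt_imp_le_of_dense fun e he => ?_
  exact le_liminf_of_le (by isBoundedDefault) (((hu y e he).prod_inr _).mono fun p hp => hp.le)

/-- An action found in the limit depends on `ε`, so only the infimum is bounded here; attainment
follows separately from inf-compactness. -/
theorem AssumptionWStar.iInf_le_raisedBar_add [BorelSpace A] (hW : M.AssumptionWStar)
    (hL : ∀ p ∈ M.graph, -((L : ℝ) : EReal) ≤ M.cost p)
    (hm : ∀ a : NNReal, a < 1 → M.raisedMin L a ≠ ⊤) (hbar : M.raisedBar L ≠ ⊤) (x : X)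
    (hx : M.raisedLimit L x ≠ ⊤) :
    ⨅ b ∈ M.actions x, (M.raisedCost L (x, b) + ∫⁻ y, M.raisedLimit L y ∂(M.trans (x, b)))
      ≤ M.raisedBar L + M.raisedLimit L x := by
  refine ENNReal.le_of_forall_pos_le_add fun ε hε _ => ?_
  -- One third each for the convergence of `u_α(y)` to `u(x)`, for the upper limit of `(1 - α) m_α`,
  -- and for the choice of a nearly optimal action.
  have hδ : (ε : ℝ≥0∞) / 3 ≠ 0 := by
    simpa [ENNReal.div_eq_zero_iff] using hε.ne'
  have hδ3 : (ε : ℝ≥0∞) / 3 + ε / 3 + ε / 3 = ε := ENNReal.add_thirds _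
  obtain ⟨p, hpt, hp⟩ := exists_seq_tendsto_liminf
    (u := fun p : ℝ × X => M.raisedRel L p.1.toNNReal p.2) (f := 𝓝[<] (1 : ℝ) ×ˢ 𝓝 x)
  have hα : Tendsto (fun n => (p n).1) atTop (𝓝[<] 1) := tendsto_fst.comp hp
  have hev : ∀ᶠ n in atTop, (p n).1.toNNReal < 1 ∧
      M.raisedRel L (p n).1.toNNReal (p n).2 < M.raisedLimit L x + ε / 3 ∧
      (1 - ((p n).1.toNNReal : ℝ≥0∞)) * M.raisedMin L (p n).1.toNNReal
        < M.raisedBar L + ε / 3 := by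
    filter_upwards [hα.eventually eventually_toNNReal_lt_one,
      hpt.eventually_lt_const (ENNReal.lt_add_right hx hδ),
      hα.eventually (eventually_lt_of_limsup_lt (ENNReal.lt_add_right hbar hδ))] with n h1 h2 h3
    exact ⟨h1.1, h2, h3⟩
  obtain ⟨N, hN⟩ := eventually_atTop.1 hev
  have hshift := tendsto_add_atTop_nat N
  choose b hb hle using fun n => M.exists_raisedCost_add_le L (hN (n + N) (by omega)).1
    (hm _ (hN (n + N) (by omega)).1) (p (n + N)).2 hδ
  have hC : M.raisedBar L + M.raisedLimit L x + ε ≠ ⊤ :=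
    ENNReal.add_ne_top.2 ⟨ENNReal.add_ne_top.2 ⟨hbar, hx⟩, ENNReal.coe_ne_top⟩
  -- The discount factor in front of `u_α` tends to 1 and does not lower the joint lower limit.
  have hlow : ∀ y, M.raisedLimit L y ≤ liminf (fun q : ℕ × X =>
      ((p (q.1 + N)).1.toNNReal : ℝ≥0∞) * M.raisedRel L (p (q.1 + N)).1.toNNReal q.2)
        (atTop ×ˢ 𝓝 y) := fun y => by
    refine le_of_forall_lt_imp_le_of_dense fun e he => ?_
    obtain ⟨e', he', hlt⟩ := exists_between he
    have h1 : Tendsto (fun α : ℝ => (α.toNNReal : ℝ≥0∞) * e') (𝓝[<] 1) (𝓝 (1 * e')) :=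
      ENNReal.Tendsto.mul_const tendsto_toNNReal_nhdsLT_one (Or.inr (hlt.trans_le le_top).ne)
    have h2 : ∀ᶠ q : ℝ × X in 𝓝[<] (1 : ℝ) ×ˢ 𝓝 y,
        e ≤ (q.1.toNNReal : ℝ≥0∞) * M.raisedRel L q.1.toNNReal q.2 := by
      filter_upwards [eventually_lt_of_lt_liminf hlt,
        (h1.eventually_const_lt (by rwa [one_mul])).prod_inl _] with q hq1 hq2
      exact hq2.le.trans (by gcongr)
    have h3 : Tendsto (fun q : ℕ × X => ((p (q.1 + N)).1, q.2)) (atTop ×ˢ 𝓝 y)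
        (𝓝[<] (1 : ℝ) ×ˢ 𝓝 y) := (hα.comp hshift).prodMap tendsto_id
    exact le_liminf_of_le (by isBoundedDefault) (h3.eventually h2)
  have hup : ∀ n, M.raisedCost L ((p (n + N)).2, b n)
      + ∫⁻ y, ((p (n + N)).1.toNNReal : ℝ≥0∞) * M.raisedRel L (p (n + N)).1.toNNReal y
        ∂(M.trans ((p (n + N)).2, b n)) ≤ M.raisedBar L + M.raisedLimit L x + ε := fun n => by
    obtain ⟨-, h2, h3⟩ := hN (n + N) (by omega)
    rw [lintegral_const_mul' _ _ ENNReal.coe_ne_top]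
    refine (hle n).trans ?_
    calc _ ≤ (M.raisedLimit L x + ε / 3) + (M.raisedBar L + ε / 3) + ε / 3 := by
          gcongr
      _ = M.raisedBar L + M.raisedLimit L x + (ε / 3 + ε / 3 + ε / 3) := by ring
      _ = _ := by rw [hδ3]
  obtain ⟨b₀, hb₀, -, hle₀⟩ := hW.exists_mapClusterPt hL ((tendsto_snd.comp hp).comp hshift) hb
    (f := fun n y => ((p (n + N)).1.toNNReal : ℝ≥0∞) * M.raisedRel L (p (n + N)).1.toNNReal y)
    hlow hC hup
  exact iInf₂_le_of_le b₀ hb₀ hle₀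

end Limits

end MDP

/-! ### Assembly of the theorem -/

theorem mainTheorem1
    {E F : Type*} [TopologicalSpace E] [PolishSpace E] [MeasurableSpace E] [BorelSpace E]
    [TopologicalSpace F] [PolishSpace F] [MeasurableSpace F] [BorelSpace F]
    (X : Set E) (hX : MeasurableSet X) (A : Set F) (hA : MeasurableSet A)
    (M : MDP X A) (hW : M.AssumptionWStar) (hB : M.AssumptionB) :
    -- there is a stationary policy that satisfies the optimality inequality, is average-cost
    -- optimal and attains the common value
    (∃ φ : M.StationaryPolicy,
      (∀ x, M.oneStep M.relLimit x (φ.toFun x) ≤ M.wBar + M.relLimit x) ∧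
      M.IsAvgOptimal φ.toPolicy ∧
      ∀ x, M.avgValue x = M.avgCost φ.toPolicy x ∧
        M.avgCost φ.toPolicy x
          = limsup (fun α : ℝ => ((1 - α : ℝ) : EReal) * M.discValue α x) (𝓝[<] 1) ∧
        limsup (fun α : ℝ => ((1 - α : ℝ) : EReal) * M.discValue α x) (𝓝[<] 1) = M.wBar ∧
        M.wBar = M.wStar) ∧
    -- (a)
    ((∀ x, 0 ≤ M.relLimit x ∧ M.relLimit x < ⊤) ∧ LowerSemicontinuous M.relLimit) ∧
    -- (b)
    ((∀ x, (M.acoiActions M.relLimit x).Nonempty) ∧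
      MeasurableSet {p : X × A | p.2 ∈ M.acoiActions M.relLimit p.1} ∧
      ∀ x, IsCompact (M.acoiActions M.relLimit x)) ∧
    -- (c)
    (∀ φ : M.StationaryPolicy, (∀ x, φ.toFun x ∈ M.acoiActions M.relLimit x) →
      (∀ x, M.oneStep M.relLimit x (φ.toFun x) ≤ M.wBar + M.relLimit x) ∧
      M.IsAvgOptimal φ.toPolicy ∧
      ∀ x, M.avgValue x = M.avgCost φ.toPolicy x ∧
        M.avgCost φ.toPolicy x
          = limsup (fun α : ℝ => ((1 - α : ℝ) : EReal) * M.discValue α x) (𝓝[<] 1) ∧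
        limsup (fun α : ℝ => ((1 - α : ℝ) : EReal) * M.discValue α x) (𝓝[<] 1) = M.wBar ∧
        M.wBar = M.wStar) ∧
    -- (d)
    ((∀ x, M.minActions M.relLimit x ⊆ M.acoiActions M.relLimit x) ∧
      ∃ φ : M.StationaryPolicy, ∀ x, φ.toFun x ∈ M.minActions M.relLimit x) ∧
    -- (e)
    (M.AssumptionWu → InfCompactOn M.relLimit Set.univ) := by
  obtain ⟨L, hL⟩ := M.exists_neg_le_cost
  have hstar : (⨅ x, ⨅ π : M.Policy, M.raisedAvg L π x) < ⊤ := by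
    have h := hB.general
    rwa [MDP.wStar_eq_lowerBy hL, lowerBy_lt_top] at h
  have hm : ∀ a : NNReal, a < 1 → M.raisedMin L a ≠ ⊤ := fun a ha => M.raisedMin_ne_top L hstar ha
  have hbar : M.raisedBar L ≠ ⊤ :=
    ((le_iInf fun x => le_iInf fun π => M.raisedBar_le_raisedAvg L π x).trans_lt hstar).ne
  have hrel := MDP.relLimit_eq_coe hL hm
  have hfin : ∀ x, M.relLimit x < ⊤ := fun x =>
    (M.relLimit_le_liminf_relDisc x).trans_lt (hB.liminf_lt x)
  have hu : ∀ x, M.raisedLimit L x ≠ ⊤ := fun x h => by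
    have := hfin x
    simp [hrel, h] at this
  have hlsc := M.lowerSemicontinuous_raisedLimit L
  have hK := hW.seqInfCompact hL hlsc
  have hinf := fun x => hW.iInf_le_raisedBar_add hL hm hbar x (hu x)
  have hsum : ∀ x, M.raisedBar L + M.raisedLimit L x ≠ ⊤ := fun x =>
    ENNReal.add_ne_top.2 ⟨hbar, hu x⟩
  have hacoi : ∀ x, M.acoiActions M.relLimit x = {b | b ∈ M.actions x ∧
      M.raisedCost L (x, b) + ∫⁻ y, M.raisedLimit L y ∂(M.trans (x, b))
        ≤ M.raisedBar L + M.raisedLimit L x} := fun x => by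
    ext b
    refine and_congr_right fun hb => ?_
    rw [hrel, MDP.oneStep_eq_lowerBy hL _ hb, MDP.wBar_eq_lowerBy hL, lowerBy_add_coe_ennreal,
      lowerBy_le_lowerBy]
  have hmin : ∀ x, ∀ b ∈ M.actions x, (b ∈ M.minActions M.relLimit x ↔
      M.raisedCost L (x, b) + ∫⁻ y, M.raisedLimit L y ∂(M.trans (x, b))
        = ⨅ b ∈ M.actions x,
          (M.raisedCost L (x, b) + ∫⁻ y, M.raisedLimit L y ∂(M.trans (x, b)))) :=
    fun x b hb => by
    have h1 : (⨅ b ∈ M.actions x, M.oneStep M.relLimit x b) = lowerBy L (⨅ b ∈ M.actions x,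
        (M.raisedCost L (x, b) + ∫⁻ y, M.raisedLimit L y ∂(M.trans (x, b)))) := by
      simp_rw [lowerBy_iInf]
      refine iInf_congr fun b => iInf_congr fun hb => ?_
      rw [hrel, MDP.oneStep_eq_lowerBy hL _ hb]
    refine (and_iff_right hb).trans ?_
    rw [h1, hrel, MDP.oneStep_eq_lowerBy hL _ hb, eq_comm]
    exact ⟨fun h => le_antisymm (lowerBy_le_lowerBy.1 h.le) (lowerBy_le_lowerBy.1 h.ge),
      fun h => by rw [h]⟩
  have hopt : ∀ φ : M.StationaryPolicy, (∀ x, φ.toFun x ∈ M.acoiActions M.relLimit x) → _ :=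
    fun φ hφ => And.intro (fun x => (hφ x).2) (MDP.isAvgOptimal_of_raisedCost_add_le hL φ hu
      fun x => by
        have := hφ x
        rw [hacoi] at this
        exact this.2)
  -- The minimum is at most `w̄ + u(x)`, so minimizers satisfy the optimality inequality; this also
  -- makes the sets `A^*(x)` nonempty.
  have hsub : ∀ x, M.minActions M.relLimit x ⊆ M.acoiActions M.relLimit x := fun x b hb => by
    rw [hacoi]
    exact ⟨hb.1, ((hmin x b hb.1).1 hb).le.trans (hinf x)⟩
  obtain ⟨f, hf, hfmem⟩ := hK.exists_measurable_argmin fun x =>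
    ne_top_of_le_ne_top (hsum x) (hinf x)
  let φ : M.StationaryPolicy := ⟨f, hf, fun x => (hfmem x).1⟩
  have hφ : ∀ x, φ.toFun x ∈ M.minActions M.relLimit x := fun x =>
    (hmin x _ (hfmem x).1).2 (hfmem x).2
  have hlsc' : LowerSemicontinuous M.relLimit := lowerSemicontinuous_liminf_prod_nhds _ _
  refine ⟨⟨φ, hopt φ fun x => hsub x (hφ x)⟩, ⟨fun x => ⟨?_, hfin x⟩, hlsc'⟩,
    ⟨fun x => ⟨_, hsub x (hφ x)⟩, ?_, fun x => ?_⟩, hopt, ⟨hsub, φ, hφ⟩, fun hWu r => ?_⟩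
  · rw [hrel]
    exact EReal.coe_ennreal_nonneg _
  -- On the graph `trans` may be replaced by the kernel `transKernel`, for which integrals depend
  -- measurably on the pair.
  · have hset : {p : X × A | p.2 ∈ M.acoiActions M.relLimit p.1}
        = M.graph ∩ {p | M.raisedCost L p + ∫⁻ y, M.raisedLimit L y ∂(M.transKernel p)
          ≤ M.raisedBar L + M.raisedLimit L p.1} := by
      ext p
      have h1 : p ∈ {p : X × A | p.2 ∈ M.acoiActions M.relLimit p.1} ↔
        p ∈ M.graph ∧ M.raisedCost L p + ∫⁻ y, M.raisedLimit L y ∂(M.trans p)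
          ≤ M.raisedBar L + M.raisedLimit L p.1 := by
        rw [Set.mem_ofPred_eq, hacoi]
        rfl
      rw [h1]
      refine and_congr_right fun hp => ?_
      rw [Set.mem_ofPred_eq, M.transKernel_apply hp]
    rw [hset]
    have hc := M.measurable_raisedCost L
    have hum := hlsc.measurable
    exact M.measurableSet_graph.inter (measurableSet_le
      (hc.add hum.lintegral_kernel) (measurable_const.add (hum.comp measurable_fst)))
  · rw [hacoi]
    exact hK.isCompact x (hsum x)
  · lift M.raisedBar L to NNReal using hbar with w hw
    -- Here `w̄ = w - L`. As `u ≥ 0`, inequality (1) gives `c(x, φ(x)) ≤ w̄ + u(x)`, so the closed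
    -- level set `{u ≤ r}` lies in the projection of a compact level set of the cost.
    refine ((hWu.infCompact_cost (w - L + r)).image continuous_fst).of_isClosed_subset ?_ ?_
    · have := hlsc'.isClosed_preimage (r : EReal)
      simpa [Set.preimage] using this
    · rintro x ⟨-, hx⟩
      have hmem := hsub x (hφ x)
      refine ⟨(x, φ.toFun x), ⟨hmem.1, ?_⟩, rfl⟩
      calc M.cost (x, φ.toFun x) ≤ M.oneStep M.relLimit x (φ.toFun x) := by
            rw [hrel, MDP.oneStep_eq_lowerBy hL _ hmem.1, MDP.cost_eq_lowerBy hL hmem.1,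
              lowerBy_le_lowerBy]
            exact le_self_add
        _ ≤ M.wBar + M.relLimit x := hmem.2
        _ ≤ ((w - L + r : ℝ) : EReal) := by
            rw [MDP.wBar_eq_lowerBy hL, ← hw, lowerBy_coe, EReal.coe_add]
            gcongr
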